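/- Let $d\ge 1$. In the upper half-space model $\mathbb{H}^{d+1}=\{(x,t): x\in\mathbb{R}^d,\ t>0\}$ (curvature $-1$), let the Böröczky prototile be $B=\{(x,t): |x_i|\le 1\ (1\le i\le d),\ 1\le t\le 2\}$. Its facets are the $a$-facet $B\cap\{t=2\}$, the $2^d$ $b$-facets $\Box_\sigma=\{(x,t)\in B: t=1,\ x_i\sigma_i\ge 0 \text{ for all } i\}$ for $\sigma\in\{-1,1\}^d$, and the $2d$ $c$-facets $B\cap\{x_i=\pm1\}$; its faces are the nonempty intersections of facets. A *B-tiling* is a tiling $\mathcal{T}$ of $\mathbb{H}^{d+1}$ by isometric copies of $B$ that is face-to-face, i.e. any nonempty intersection of two distinct tiles is a face of both; if $d=1$ it is also required that, for an edge which is a $c$-edge of two tiles, the orientations from the $a$-edge towards the $b$-edges given by the two tiles agree. Let $\mathcal{T}$ be a B-tiling, and let $g$ be an isometry of $\mathbb{H}^{d+1}$ such that $g(B)\in\mathcal{T}$. If a tile has the form $T=g(h(B))$ with $h(x,t)=(2^kx+v,\,2^kt)$, $k\in\mathbb{Z}$, $v\in\mathbb{R}^d$, then the $b$-facet $g(h(\Box_\sigma))$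 of $T$ is given the label $\sigma$. Two tiles lie in the same layer if, for some $k\in\mathbb{Z}$, both are contained in $g(\{2^k\le t\le 2^{k+1}\})$. The tail of a tile $T$ is the sequence of pairwise distinct tiles $T=T_0,T_1,T_2,\ldots$ of $\mathcal{T}$ such that, for each $j\ge1$, the $a$-facet of $T_{j-1}$ is a $b$-facet of $T_j$; its sequence is $s(T)=(\sigma^{(j)})_{j\ge1}$, where $\sigma^{(j)}=(\sigma^{(j)}_1,\ldots,\sigma^{(j)}_d)\in\{-1,1\}^d$ is the label of that $b$-facet of $T_j$. Then the sequence $s(T)$ exists and is unique for every $T\in\mathcal{T}$. For any $T,\tilde T\in\mathcal{T}$, with $s(T)=(\sigma^{(j)})_{j\ge 1}$ and $s(\tilde T)=(\tilde\sigma^{(j)})_{j\ge 1}$, there are $m,n\in\mathbb{N}$ such that for each $i\le d$ $$\forall j\ge 1:\ \sigma^{(j+m)}_i=\tilde\sigma^{(j+n)}_i\qquad\text{or}\qquad \forall j\ge 1:\ \sigma^{(j+m)}_i=-\tilde\sigma^{(j+n)}_i .$$ If $T$ and $\tilde T$ lie in the same layer, then there is $m\in\mathbb{N}$ such that for each $i\le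 d$ $$\forall j\ge m:\ \sigma^{(j)}_i=\tilde\sigma^{(j)}_i\qquad\text{or}\qquad \forall j\ge m:\ \sigma^{(j)}_i=-\tilde\sigma^{(j)}_i .$$ -/

import Mathlib

namespace Boroczky

/-- Hyperbolic space of dimension `d + 1` and curvature `-1`, in the upper half-space model:
points `(x, t)` with `x` in Euclidean `d`-space and height `t > 0`. The horospheres centred at the
ideal point `∞` are the level sets of `t`. -/
structure HSpace (d : ℕ) where
  x : EuclideanSpace ℝ (Fin d)
  t : ℝ
  pos : 0 < t

/-- The topology of the half-space (it is also the one given by the hyperbolic distance). -/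
instance (d : ℕ) : TopologicalSpace (HSpace d) :=
  TopologicalSpace.induced (fun p => (p.x, p.t)) inferInstance

/-- The hyperbolic distance,
`2 arsinh (|p - q| / (2 √(t s)))`, as for `UpperHalfPlane` in the case `d = 1`. -/
noncomputable def hdist {d : ℕ} (p q : HSpace d) : ℝ :=
  2 * Real.arsinh (Real.sqrt (dist p.x q.x ^ 2 + (p.t - q.t) ^ 2) / (2 * Real.sqrt (p.t * q.t)))

/-- Isometries of hyperbolic space: bijections that preserve the hyperbolic distance. -/
structure HIsom (d : ℕ) extends HSpace d ≃ HSpace d where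
  hdist_map : ∀ p q, hdist (toFun p) (toFun q) = hdist p q

instance (d : ℕ) : CoeFun (HIsom d) (fun _ => HSpace d → HSpace d) := ⟨fun g => g.toFun⟩

/-! ### The prototile

The outer horosphere `E₁` is `t = 1`, on which the intrinsic length is the Euclidean one, and the
inner horosphere `E₀`, at distance `log 2` from it, is `t = 2`, on which intrinsic lengths are half
the Euclidean ones. The prototile is the part above the cube `[-1,1]^d` of the layer between
them. -/

/-- The Böröczky prototile. -/
def prototile (d : ℕ) : Set (HSpace d) :=
  {p | (∀ i, |p.x i| ≤ 1) ∧ 1 ≤ p.t ∧ p.t ≤ 2}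

/-- The names of the `1 + 2^d + 2d` facets of the prototile. -/
inductive FacetName (d : ℕ) where
  | a : FacetName d
  | b (σ : Fin d → ℤˣ) : FacetName d
  | c (i : Fin d) (ε : ℤˣ) : FacetName d

/-- The facets of the prototile: the `a`-facet is the unit cube in `E₀`; the `b`-facets are the
unit cubes `x_i σ_i ≥ 0` into which the cube of edge length `2` in `E₁` is divided; the `c`-facets
lie in the hyperplanes `x_i = ±1`. -/
def facet {d : ℕ} : FacetName d → Set (HSpace d)
  | .a => {p | p ∈ prototile d ∧ p.t = 2}
  | .b σ => {p | p ∈ prototile d ∧ p.t = 1 ∧ ∀ i, 0 ≤ p.x i * ((σ i : ℤ) : ℝ)}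
  | .c i ε => {p | p ∈ prototile d ∧ p.x i = ((ε : ℤ) : ℝ)}

/-! ### Copies of the prototile and their faces -/

/-- `T` is a copy of the prototile. -/
def IsCopy {d : ℕ} (T : Set (HSpace d)) : Prop :=
  ∃ g : HIsom d, T = g '' prototile d

/-- `F` is a face of the copy `T` of the prototile. The faces of the prototile are its facets and
their nonempty intersections. -/
def IsFace {d : ℕ} (T F : Set (HSpace d)) : Prop :=
  ∃ g : HIsom d, T = g '' prototile d ∧
    ∃ S : Set (FacetName d), S.Nonempty ∧ (⋂ f ∈ S, facet f).Nonempty ∧ F = g '' (⋂ f ∈ S, facet f)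

/-- `F` is the `a`-facet of `T`. -/
def IsAFacet {d : ℕ} (T F : Set (HSpace d)) : Prop :=
  ∃ g : HIsom d, T = g '' prototile d ∧ F = g '' facet .a

/-- `F` is a `c`-facet of `T`. -/
def IsCFacet {d : ℕ} (T F : Set (HSpace d)) : Prop :=
  ∃ g : HIsom d, T = g '' prototile d ∧ ∃ i ε, F = g '' facet (.c i ε)

/-- Böröczky tilings of hyperbolic space of dimension `d + 1`: face-to-face tilings by copies of
the prototile. In the hyperbolic plane (`d = 1`) the `c`-edges are oriented from the `a`-edge
towards the `b`-edges, and the tiling has to respect this orientation: the starting point of an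
edge that is a `c`-edge of two tiles is the same for both tiles. -/
structure IsBTiling {d : ℕ} (𝒯 : Set (Set (HSpace d))) : Prop where
  copy : ∀ T ∈ 𝒯, IsCopy T
  cover : ⋃₀ 𝒯 = Set.univ
  no_overlap : ∀ T ∈ 𝒯, ∀ T' ∈ 𝒯, T ≠ T' → Disjoint (interior T) (interior T')
  face_to_face : ∀ T ∈ 𝒯, ∀ T' ∈ 𝒯, T ≠ T' → (T ∩ T').Nonempty →
    IsFace T (T ∩ T') ∧ IsFace T' (T ∩ T')
  oriented : d = 1 → ∀ T ∈ 𝒯, ∀ T' ∈ 𝒯, ∀ F A A' : Set (HSpace d),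
    IsCFacet T F → IsCFacet T' F → IsAFacet T A → IsAFacet T' A' → F ∩ A = F ∩ A'

/-! ### Layers and labels

An isometry `g` with `g '' prototile d ∈ 𝒯` fixes a tile of the tiling, the names of its
`b`-facets, its line `ℓ = g {x = 0}` and the horospheres `E_i`. -/

/-- The shift along `ℓ = {x = 0}` by `k` layers, followed by the translation of the layers (a
parabolic isometry) by the vector `v`. -/
noncomputable def shift {d : ℕ} (k : ℤ) (v : EuclideanSpace ℝ (Fin d)) (p : HSpace d) : HSpace d :=
  ⟨(2 : ℝ) ^ k • p.x + v, (2 : ℝ) ^ k * p.t, mul_pos (zpow_pos two_pos k) p.pos⟩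

/-- `F` is the `b`-facet of the tile `T` with label `σ`: the labels of the `b`-facets of the tile
`g '' prototile d` are carried to `T` by a shift along `ℓ` and a translation of the layers. -/
def IsBFacetLabelled {d : ℕ} (g : HIsom d) (T F : Set (HSpace d)) (σ : Fin d → ℤˣ) : Prop :=
  ∃ (k : ℤ) (v : EuclideanSpace ℝ (Fin d)),
    T = g '' (shift k v '' prototile d) ∧ F = g '' (shift k v '' facet (.b σ))

/-- `T` and `T'` lie in the same layer, that is, between the same two consecutive horospheres. -/
def SameLayer {d : ℕ} (g : HIsom d) (T T' : Set (HSpace d)) : Prop :=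
  ∃ k : ℤ, T ⊆ g '' {p | (2 : ℝ) ^ k ≤ p.t ∧ p.t ≤ (2 : ℝ) ^ (k + 1)} ∧
    T' ⊆ g '' {p | (2 : ℝ) ^ k ≤ p.t ∧ p.t ≤ (2 : ℝ) ^ (k + 1)}

/-- `t` is the tail of `T` in `𝒯`, with sequence `s`: `t` is an infinite horospheric path
`T = t 0, t 1, …` of pairwise distinct tiles that always goes down, i.e. the `a`-facet of `t j` is
a `b`-facet of `t (j + 1)`, and `s j` is the label of that `b`-facet. (So `s j` is the term
`σ^(j+1)` when the terms of the sequence are counted from `1`.) -/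
structure IsTail {d : ℕ} (𝒯 : Set (Set (HSpace d))) (g : HIsom d) (T : Set (HSpace d))
    (t : ℕ → Set (HSpace d)) (s : ℕ → Fin d → ℤˣ) : Prop where
  start : t 0 = T
  mem : ∀ j, t j ∈ 𝒯
  inj : Function.Injective t
  down : ∀ j, ∃ F, IsAFacet (t j) F ∧ IsBFacetLabelled g (t (j + 1)) F (s j)

/-- `s` is the sequence `s(T)` of the tail of `T`. -/
def IsTailSequence {d : ℕ} (𝒯 : Set (Set (HSpace d))) (g : HIsom d) (T : Set (HSpace d))
    (s : ℕ → Fin d → ℤˣ) : Prop :=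
  ∃ t, IsTail 𝒯 g T t s

end Boroczky

namespace Boroczky

variable {d : ℕ}

attribute [-simp] Equiv.toFun_as_coe

/-! ### Isometries of the half-space -/

/-! After undoing `g`, the tiling is a dyadic grid: the tiles in layer `k` are the sets `shift k v
'' prototile d`, with `v` running over one coset of `2^(k+1) ℤ^d`. The theorem then becomes
arithmetic in ℤ.

The grid comes from crossing facets. Covering and compactness put another tile across every facet
(`IsTil.exists_across`), and the shared facet must be of a compatible kind, since a vertical segment
is never isometric to a subset of a horosphere. The curvature of horospheres makes an `a`-facet
determine its tile (`image_prototile_of_image_facet_a`), so an `a`-facet is glued to a `b`-facet,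
giving a parent (`IsTil.exists_parent`) and all children (`IsTil.child_mem`). Across a `c`-facet the
gluing preserves the vertical axis, by `axis_map_eq` or, for `d = 1`, by the orientation condition,
so the neighbour is a horizontal translate (`IsTil.sibling_mem`). Translates and parents fill the
half-space, and a tile is determined by one of its interior points (`IsTil.eq_of_mem_open`), so
there are no other tiles.

A parent of `(k, v)` is `(k + 1, v - 2^k σ)`. Two parents of one tile differ by `2^k (σ - τ)`, which
must lie in `2^(k+2) ℤ^d`; hence `σ = τ` and tails are unique. For two tails aligned by layer, let
`z_j` be one coordinate of the difference of positions, divided by the period of the layer. Then `2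
z_j = 4 z_{j+1} + (σ_j - τ_j)`, so `|z_j|` shrinks to 0 or 1. At 0 the signs agree from then on; if
0 is never reached, they are eventually opposite (`eventually_eq_or_neg`). -/

@[ext] theorem HSpace.ext {p q : HSpace d} (hx : p.x = q.x) (ht : p.t = q.t) : p = q := by
  cases p; cases q; simp_all

/-- `2 (cosh (hdist p q) - 1)`, a rational function of the coordinates. -/
noncomputable def qd (p q : HSpace d) : ℝ :=
  (dist p.x q.x ^ 2 + (p.t - q.t) ^ 2) / (p.t * q.t)

theorem hdist_eq_iff {p q p' q' : HSpace d} : hdist p q = hdist p' q' ↔ qd p q = qd p' q' := by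
  have key : ∀ p q : HSpace d, Real.sqrt (dist p.x q.x ^ 2 + (p.t - q.t) ^ 2) /
      (2 * Real.sqrt (p.t * q.t)) = Real.sqrt (qd p q) / 2 := by
    intro p q
    rw [qd, Real.sqrt_div (by positivity)]
    field_simp
  have nn : ∀ p q : HSpace d, 0 ≤ qd p q := by
    intro p q
    have := mul_pos p.pos q.pos
    unfold qd
    positivity
  unfold hdist
  rw [key, key]
  constructor
  · intro h
    have h1 := Real.arsinh_injective (mul_left_cancel₀ two_ne_zero h)
    exact (Real.sqrt_inj (nn _ _) (nn _ _)).1 (by linarith)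
  · intro h
    rw [h]

namespace HIsom

theorem qd_map (g : HIsom d) (p q : HSpace d) : qd (g p) (g q) = qd p q :=
  hdist_eq_iff.1 (g.hdist_map p q)

/-- The inverse isometry. -/
def symm (g : HIsom d) : HIsom d where
  toEquiv := g.toEquiv.symm
  hdist_map p q := by
    rw [← g.hdist_map]
    exact congrArg₂ hdist (g.toEquiv.apply_symm_apply p) (g.toEquiv.apply_symm_apply q)

@[simp] theorem symm_apply (g : HIsom d) (p : HSpace d) : g.symm (g p) = p :=
  g.toEquiv.symm_apply_apply p

@[simp] theorem apply_symm (g : HIsom d) (p : HSpace d) : g (g.symm p) = p :=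
  g.toEquiv.apply_symm_apply p

theorem injective (g : HIsom d) : Function.Injective g := g.toEquiv.injective

/-- The composition of isometries. -/
def comp (g h : HIsom d) : HIsom d where
  toEquiv := h.toEquiv.trans g.toEquiv
  hdist_map p q := (g.hdist_map (h p) (h q)).trans (h.hdist_map p q)

@[simp] theorem comp_apply (g h : HIsom d) (p : HSpace d) : g.comp h p = g (h p) := rfl

theorem comp_image (g h : HIsom d) (S : Set (HSpace d)) : g.comp h '' S = g '' (h '' S) := by
  rw [Set.image_image]; rfl

theorem mem_image (g : HIsom d) (S : Set (HSpace d)) (p : HSpace d) :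
    p ∈ g '' S ↔ g.symm p ∈ S := by
  constructor
  · rintro ⟨q, hq, rfl⟩
    simpa using hq
  · intro h
    exact ⟨_, h, by simp⟩

@[simp] theorem symm_image_image (g : HIsom d) (S : Set (HSpace d)) :
    g.symm '' (g '' S) = S := by
  rw [Set.image_image]; simp

@[simp] theorem image_symm_image (g : HIsom d) (S : Set (HSpace d)) :
    g '' (g.symm '' S) = S := by
  rw [Set.image_image]; simp

theorem image_eq_iff (g : HIsom d) (S S' : Set (HSpace d)) : g '' S = S' ↔ S = g.symm '' S' := by
  constructor
  · rintro rfl; simp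
  · rintro rfl; simp

theorem image_injective (g : HIsom d) {S S' : Set (HSpace d)} (h : g '' S = g '' S') : S = S' :=
  g.injective.image_injective h

end HIsom

/-- The shifts as isometries. -/
noncomputable def shiftIsom (k : ℤ) (v : EuclideanSpace ℝ (Fin d)) : HIsom d where
  toFun := shift k v
  invFun := shift (-k) (-((2 : ℝ) ^ (-k) • v))
  left_inv p := by
    have : (2 : ℝ) ^ k ≠ 0 := by positivity
    ext1
    · simp [shift, smul_smul, this]
    · simp [shift, this]
  right_inv p := by
    have : (2 : ℝ) ^ k ≠ 0 := by positivity
    ext1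
    · simp [shift, smul_smul, this]
    · simp [shift, this]
  hdist_map p q := by
    have : (0 : ℝ) < (2 : ℝ) ^ k := by positivity
    have hp := p.pos
    have hq := q.pos
    rw [hdist_eq_iff]
    simp only [qd, shift]
    rw [dist_add_right, dist_smul₀, Real.norm_of_nonneg this.le]
    field_simp

@[simp] theorem shiftIsom_apply (k : ℤ) (v : EuclideanSpace ℝ (Fin d)) (p : HSpace d) :
    shiftIsom k v p = shift k v p := rfl

theorem shiftIsom_image (k : ℤ) (v : EuclideanSpace ℝ (Fin d)) (S : Set (HSpace d)) :
    shiftIsom k v '' S = shift k v '' S := rfl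

theorem shift_shift (k l : ℤ) (v w : EuclideanSpace ℝ (Fin d)) (p : HSpace d) :
    shift k v (shift l w p) = shift (k + l) ((2 : ℝ) ^ k • w + v) p := by
  ext1
  · simp [shift, smul_smul, zpow_add₀, add_assoc]
  · simp [shift, zpow_add₀, mul_assoc]

theorem shift_image_shift (k l : ℤ) (v w : EuclideanSpace ℝ (Fin d)) (S : Set (HSpace d)) :
    shift k v '' (shift l w '' S) = shift (k + l) ((2 : ℝ) ^ k • w + v) '' S := by
  rw [Set.image_image]; simp only [shift_shift]

theorem shift_zero (p : HSpace d) : shift 0 0 p = p := by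
  ext1 <;> simp [shift]

theorem shift_zero_image (S : Set (HSpace d)) : shift 0 0 '' S = S := by
  simp [shift_zero]

/-- The point above `x` at height `1`. -/
noncomputable abbrev pt1 (x : EuclideanSpace ℝ (Fin d)) : HSpace d := ⟨x, 1, one_pos⟩

/-- The point above `x` at height `2`. -/
noncomputable abbrev pt2 (x : EuclideanSpace ℝ (Fin d)) : HSpace d := ⟨x, 2, two_pos⟩

/-- Up to constants the two distances are `(r² + t² + 1) / t` and `(r² + t² + 4) / t`; their
difference `3 / t` depends on the height alone. This is how isometries are shown to fix the ideal
point `∞`. -/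
theorem t_eq_of_vertical (h : HIsom d) {w w' : EuclideanSpace ℝ (Fin d)}
    (h1 : h (pt1 w) = pt1 w') (h2 : h (pt2 w) = pt2 w') (p : HSpace d) : (h p).t = p.t := by
  have e1 := h.qd_map p (pt1 w)
  have e2 := h.qd_map p (pt2 w)
  rw [h1] at e1
  rw [h2] at e2
  have hp := p.pos
  have hq := (h p).pos
  simp only [qd] at e1 e2
  set r := dist (h p).x w'
  set r' := dist p.x w
  set t := (h p).t
  set s := p.t
  field_simp at e1 e2
  nlinarith

theorem dist_eq_of_t_eq (h : HIsom d) (ht : ∀ p, (h p).t = p.t) (p q : HSpace d) :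
    dist (h p).x (h q).x = dist p.x q.x := by
  have e := h.qd_map p q
  have hp := p.pos
  have hq := q.pos
  simp only [qd, ht] at e
  field_simp at e
  have : dist (h p).x (h q).x ^ 2 = dist p.x q.x ^ 2 := by linarith
  exact (pow_left_inj₀ dist_nonneg dist_nonneg two_ne_zero).1 this

theorem symm_t_eq (h : HIsom d) (ht : ∀ p, (h p).t = p.t) (p : HSpace d) :
    (h.symm p).t = p.t := by
  have := ht (h.symm p)
  simpa using this.symm

/-- Once heights are preserved so are horizontal distances, in particular distance 0: vertical lines
go to vertical lines. -/
theorem exists_isometryEquiv (h : HIsom d) (ht : ∀ p, (h p).t = p.t) :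
    ∃ φ : EuclideanSpace ℝ (Fin d) ≃ᵢ EuclideanSpace ℝ (Fin d),
      ∀ p, h p = ⟨φ p.x, p.t, p.pos⟩ := by
  have hx : ∀ p, (h (pt1 p.x)).x = (h p).x := by
    intro p
    have := dist_eq_of_t_eq h ht (pt1 p.x) p
    simpa using this
  have hx' : ∀ p, (h.symm (pt1 p.x)).x = (h.symm p).x := by
    intro p
    have := dist_eq_of_t_eq h.symm (symm_t_eq h ht) (pt1 p.x) p
    simpa using this
  refine ⟨⟨⟨fun x => (h (pt1 x)).x, fun x => (h.symm (pt1 x)).x, ?_, ?_⟩, ?_⟩, ?_⟩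
  · intro x
    simp [hx']
  · intro x
    simp [hx]
  · refine Isometry.of_dist_eq fun x y => ?_
    exact dist_eq_of_t_eq h ht _ _
  · intro p
    ext1
    · exact (hx p).symm
    · exact ht p

/-! ### Lower-dimensional prototiles and isometries between them -/

theorem dist_sq_eq (x y : EuclideanSpace ℝ (Fin d)) : dist x y ^ 2 = ∑ i, (x i - y i) ^ 2 := by
  rw [EuclideanSpace.dist_eq, Real.sq_sqrt (by positivity)]
  simp [Real.dist_eq]

/-- The prototile in the coordinate directions `J`, with axis over `w`. -/
def box (J : Finset (Fin d)) (w : EuclideanSpace ℝ (Fin d)) : Set (HSpace d) :=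
  {p | (∀ i ∈ J, |p.x i - w i| ≤ 1) ∧ (∀ i ∉ J, p.x i = w i) ∧ 1 ≤ p.t ∧ p.t ≤ 2}

/-- `v` is a vertex of the cube in the directions `J` with centre `w`. -/
def IsCorner (J : Finset (Fin d)) (w v : EuclideanSpace ℝ (Fin d)) : Prop :=
  (∀ i ∈ J, (v i - w i) ^ 2 = 1) ∧ ∀ i ∉ J, v i = w i

theorem IsCorner.dist_sq {J : Finset (Fin d)} {w v : EuclideanSpace ℝ (Fin d)}
    (h : IsCorner J w v) : dist v w ^ 2 = J.card := by
  rw [dist_sq_eq, ← Finset.sum_subset (Finset.subset_univ J)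
    (fun i _ hi => by rw [h.2 i hi]; ring), Finset.sum_congr rfl h.1]
  simp

theorem IsCorner.antipode {J : Finset (Fin d)} {w v : EuclideanSpace ℝ (Fin d)}
    (h : IsCorner J w v) : IsCorner J w ((2 : ℝ) • w - v) := by
  constructor
  · intro i hi
    have := h.1 i hi
    simp only [PiLp.sub_apply, PiLp.smul_apply, smul_eq_mul]
    linarith
  · intro i hi
    have := h.2 i hi
    simp only [PiLp.sub_apply, PiLp.smul_apply, smul_eq_mul]
    linarith

theorem IsCorner.mem_box {J : Finset (Fin d)} {w v : EuclideanSpace ℝ (Fin d)}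
    (h : IsCorner J w v) {p : HSpace d} (hx : p.x = v) (h1 : 1 ≤ p.t) (h2 : p.t ≤ 2) :
    p ∈ box J w := by
  refine ⟨fun i hi => ?_, fun i hi => hx ▸ h.2 i hi, h1, h2⟩
  have := h.1 i hi
  rw [hx]
  exact abs_le_one_iff_mul_self_le_one.2 (by nlinarith)

theorem dist_sq_le_of_mem_box {J : Finset (Fin d)} {w : EuclideanSpace ℝ (Fin d)}
    {p q : HSpace d} (hp : p ∈ box J w) (hq : q ∈ box J w) : dist p.x q.x ^ 2 ≤ 4 * J.card := by
  rw [dist_sq_eq, ← Finset.sum_subset (Finset.subset_univ J)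
    (fun i _ hi => by rw [hp.2.1 i hi, hq.2.1 i hi]; ring)]
  calc _ ≤ ∑ i ∈ J, (4 : ℝ) := by
        refine Finset.sum_le_sum fun i hi => ?_
        have h1 := abs_le.1 (hp.1 i hi)
        have h2 := abs_le.1 (hq.1 i hi)
        nlinarith
    _ = _ := by simp [mul_comm]

/-- On `[1,2]` one has `(t - s)² ≤ ts - 1`, so the equation forces `4n(ts - 1) ≤ ts - 1`. -/
theorem heights_eq_one {n t s R : ℝ} (hn : 1 ≤ n) (ht : 1 ≤ t) (ht' : t ≤ 2) (hs : 1 ≤ s)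
    (hs' : s ≤ 2) (hR : R ≤ 4 * n) (h : R + (t - s) ^ 2 = 4 * n * (t * s)) :
    t = 1 ∧ s = 1 := by
  have h1 : 0 ≤ t * s - 1 := by nlinarith
  have h2 : (t - s) ^ 2 ≤ t * s - 1 := by
    rcases le_total t s with h | h <;> nlinarith
  have h3 : t * s - 1 ≤ 0 := by nlinarith
  constructor <;> nlinarith

/-- The value `4 |J|` is the maximum of `qd` on the box, attained only by antipodal corners of the
bottom. Isometries between boxes therefore respect these pairs. -/
theorem corner_of_diametral {J : Finset (Fin d)} {w : EuclideanSpace ℝ (Fin d)}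
    (hJ : 1 ≤ J.card) {p q : HSpace d} (hp : p ∈ box J w) (hq : q ∈ box J w)
    (h : qd p q = 4 * J.card) :
    IsCorner J w p.x ∧ p = pt1 p.x ∧ q = pt1 ((2 : ℝ) • w - p.x) := by
  have hn : (1 : ℝ) ≤ J.card := by exact_mod_cast hJ
  have hle := dist_sq_le_of_mem_box hp hq
  have hpp := p.pos
  have hqp := q.pos
  rw [qd, div_eq_iff (by positivity)] at h
  obtain ⟨h1, h2⟩ := heights_eq_one hn hp.2.2.1 hp.2.2.2 hq.2.2.1 hq.2.2.2 hle h
  rw [h1, h2, dist_sq_eq, ← Finset.sum_subset (Finset.subset_univ J)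
    (fun i _ hi => by rw [hp.2.1 i hi, hq.2.1 i hi]; ring)] at h
  have h4 : ∀ i ∈ J, (p.x i - q.x i) ^ 2 ≤ 4 := by
    intro i hi
    have h1 := abs_le.1 (hp.1 i hi)
    have h2 := abs_le.1 (hq.1 i hi)
    nlinarith
  have h5 : ∀ i ∈ J, (p.x i - q.x i) ^ 2 = 4 := by
    refine (Finset.sum_eq_sum_iff_of_le h4).1 ?_
    simp only [Finset.sum_const, nsmul_eq_mul]
    linarith
  have h6 : ∀ i ∈ J, (p.x i - w i) ^ 2 = 1 ∧ q.x i = 2 * w i - p.x i := by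
    intro i hi
    have h1 := abs_le.1 (hp.1 i hi)
    have h2 := abs_le.1 (hq.1 i hi)
    have h3 := h5 i hi
    have h4 : (p.x i - q.x i - 2) * (p.x i - q.x i + 2) = 0 := by linarith
    rcases mul_eq_zero.1 h4 with h | h
    · have : p.x i - w i = 1 := by linarith
      constructor
      · rw [this]; ring
      · linarith
    · have : p.x i - w i = -1 := by linarith
      constructor
      · rw [this]; ring
      · linarith
  refine ⟨⟨fun i hi => (h6 i hi).1, hp.2.1⟩, HSpace.ext rfl h1, HSpace.ext ?_ h2⟩
  ext i
  simp only [PiLp.sub_apply, PiLp.smul_apply, smul_eq_mul]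
  by_cases hi : i ∈ J
  · exact (h6 i hi).2
  · rw [hp.2.1 i hi, hq.2.1 i hi]; ring

theorem IsCorner.map {J J' : Finset (Fin d)} {w w' v : EuclideanSpace ℝ (Fin d)}
    (hJ : 1 ≤ J.card) (hJJ : J'.card = J.card) (h : HIsom d) (hb : h '' box J w = box J' w')
    (hv : IsCorner J w v) :
    ∃ v', IsCorner J' w' v' ∧ h (pt1 v) = pt1 v' ∧
      h (pt1 ((2 : ℝ) • w - v)) = pt1 ((2 : ℝ) • w' - v') := by
  have m1 : h (pt1 v) ∈ box J' w' :=
    hb ▸ Set.mem_image_of_mem _ (hv.mem_box rfl le_rfl one_le_two)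
  have m2 : h (pt1 ((2 : ℝ) • w - v)) ∈ box J' w' :=
    hb ▸ Set.mem_image_of_mem _ (hv.antipode.mem_box rfl le_rfl one_le_two)
  have hq : qd (h (pt1 v)) (h (pt1 ((2 : ℝ) • w - v))) = 4 * J'.card := by
    rw [h.qd_map, hJJ, ← hv.dist_sq]
    have : v - ((2 : ℝ) • w - v) = (2 : ℝ) • (v - w) := by module
    simp only [qd, dist_eq_norm, this, norm_smul]
    norm_num
    ring
  obtain ⟨h1, h2, h3⟩ := corner_of_diametral (hJJ ▸ hJ) m1 m2 hq
  exact ⟨_, h1, h2, h3⟩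

theorem eq_of_equidistant {J : Finset (Fin d)} {w x : EuclideanSpace ℝ (Fin d)}
    (hx : ∀ i ∉ J, x i = w i)
    (h : ∀ v, IsCorner J w v → dist x v ^ 2 = dist x ((2 : ℝ) • w - v) ^ 2) : x = w := by
  classical
  -- The corner nearest to `x`: every coordinate then contributes `4 |x i - w i|` to the difference
  -- of squared distances, with no cancellation.
  let v : EuclideanSpace ℝ (Fin d) :=
    WithLp.toLp 2 fun i => if i ∈ J then (if w i ≤ x i then w i + 1 else w i - 1) else w i
  have hv : IsCorner J w v := by
    constructor
    · intro i hi
      by_cases h : w i ≤ x i <;> simp [v, hi, h]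
    · intro i hi
      simp [v, hi]
  have := h v hv
  rw [dist_sq_eq, dist_sq_eq, ← sub_eq_zero, ← Finset.sum_sub_distrib] at this
  have key : ∀ i, (x i - ((2 : ℝ) • w - v) i) ^ 2 - (x i - v i) ^ 2 = 4 * |x i - w i| := by
    intro i
    simp only [PiLp.sub_apply, PiLp.smul_apply, smul_eq_mul]
    by_cases hi : i ∈ J
    · by_cases h : w i ≤ x i
      · rw [abs_of_nonneg (by linarith)]
        simp only [v, hi, h, if_true]
        ring
      · rw [abs_of_neg (by linarith)]
        simp only [v, hi, h, if_true, if_false]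
        ring
    · simp only [v, hi, if_false, hx i hi]
      simp
      ring
  have h0 : ∑ i, |x i - w i| = 0 := by
    have : ∑ i, 4 * |x i - w i| = 0 := by
      rw [← Finset.sum_congr rfl fun i _ => key i, ← neg_eq_zero, ← Finset.sum_neg_distrib, ← this]
      exact Finset.sum_congr rfl fun i _ => by ring
    rw [← Finset.mul_sum] at this
    linarith
  ext i
  have := (Finset.sum_eq_zero_iff_of_nonneg fun i _ => abs_nonneg (x i - w i)).1 h0 i
    (Finset.mem_univ i)
  linarith [abs_eq_zero.1 this]

theorem exists_corner (J : Finset (Fin d)) (w : EuclideanSpace ℝ (Fin d)) :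
    ∃ v, IsCorner J w v := by
  classical
  refine ⟨WithLp.toLp 2 fun i => if i ∈ J then w i + 1 else w i, ?_, ?_⟩ <;> intro i hi <;>
    simp [hi]

theorem axis_mem_box {J : Finset (Fin d)} {p : HSpace d} (h1 : 1 ≤ p.t) (h2 : p.t ≤ 2) :
    p ∈ box J p.x := by
  refine ⟨fun i _ => by simp, fun i _ => rfl, h1, h2⟩

/-- A point of the axis is equidistant from all bottom corners, hence so is its image. The common
value is `t + (|J| + 1) / t - 2`, which determines `t` up to `t ↦ (|J| + 1) / t`. -/
theorem axis_map {J J' : Finset (Fin d)} {w w' : EuclideanSpace ℝ (Fin d)}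
    (hJ : 1 ≤ J.card) (hJJ : J'.card = J.card) (h : HIsom d) (hb : h '' box J w = box J' w')
    {p : HSpace d} (hp : p.x = w) (h1 : 1 ≤ p.t) (h2 : p.t ≤ 2) :
    (h p).x = w' ∧ 1 ≤ (h p).t ∧ (h p).t ≤ 2 ∧
      ((h p).t = p.t ∨ p.t * (h p).t = J.card + 1) := by
  have hm : h p ∈ box J' w' := hb ▸ Set.mem_image_of_mem _ (hp ▸ axis_mem_box h1 h2)
  have hb' : h.symm '' box J' w' = box J w := by rw [← hb]; simp
  have hpp := p.pos
  have hqp := (h p).pos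
  have hcor : ∀ v', IsCorner J' w' v' → qd (h p) (pt1 v') = (J.card + (p.t - 1) ^ 2) / p.t := by
    intro v' hv'
    obtain ⟨v, hv, e1, -⟩ := hv'.map (hJJ ▸ hJ) hJJ.symm h.symm hb'
    have := h.qd_map p (pt1 v)
    rw [← e1, h.apply_symm, e1] at this
    rw [this, qd, hp, dist_comm, hv.dist_sq, mul_one]
  have hx : (h p).x = w' := by
    refine eq_of_equidistant hm.2.1 fun v' hv' => ?_
    have e1 := hcor _ hv'
    have e2 := hcor _ hv'.antipode
    rw [← e2] at e1
    simp only [qd] at e1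
    field_simp at e1
    linarith
  refine ⟨hx, hm.2.2.1, hm.2.2.2, ?_⟩
  obtain ⟨v', hv'⟩ := exists_corner J' w'
  have e := hcor v' hv'
  rw [qd, hx, dist_comm, hv'.dist_sq, hJJ] at e
  simp only at e
  field_simp at e
  have : ((h p).t - p.t) * (p.t * (h p).t - (J.card + 1)) = 0 := by linarith
  rcases mul_eq_zero.1 this with h | h
  · left; linarith
  · right; linarith

/-- An isometry between prototiles in coordinate directions preserves the axes. -/
theorem axis_map_eq {J J' : Finset (Fin d)} {w w' : EuclideanSpace ℝ (Fin d)}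
    (hJ : 1 ≤ J.card) (hJJ : J'.card = J.card) (h : HIsom d) (hb : h '' box J w = box J' w') :
    h (pt1 w) = pt1 w' ∧ h (pt2 w) = pt2 w' := by
  obtain ⟨x1, a1, b1, c1⟩ := axis_map hJ hJJ h hb (p := pt1 w) rfl le_rfl one_le_two
  obtain ⟨x2, a2, b2, c2⟩ := axis_map hJ hJJ h hb (p := pt2 w) rfl one_le_two le_rfl
  have hn : (1 : ℝ) ≤ J.card := by exact_mod_cast hJ
  have e := h.qd_map (pt1 w) (pt2 w)
  have p1 := (h (pt1 w)).pos
  have p2 := (h (pt2 w)).pos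
  rw [qd, qd, x1, x2] at e
  simp only [dist_self] at e
  field_simp at e
  have e' : ((h (pt1 w)).t - 2 * (h (pt2 w)).t) * (2 * (h (pt1 w)).t - (h (pt2 w)).t) = 0 := by
    linarith
  suffices hs : (h (pt1 w)).t = 1 by
    refine ⟨HSpace.ext x1 hs, HSpace.ext x2 ?_⟩
    rw [hs] at e'
    rcases mul_eq_zero.1 e' with h | h
    · change _ = (2 : ℝ); linarith
    · change _ = (2 : ℝ); linarith
  rcases c1 with c1 | c1
  · exact c1
  -- The remaining possibility is `|J| = 1` with the ends of the axis exchanged. Distances to the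
  -- bottom corners do not exclude it, but a top corner would be sent to height `4/5 < 1`.
  exfalso
  simp only [one_mul] at c1
  have hn1 : (J.card : ℝ) = 1 := by linarith
  have t1 : (h (pt1 w)).t = 2 := by linarith
  have t2 : (h (pt2 w)).t = 1 := by
    rw [t1] at e'
    rcases mul_eq_zero.1 e' with h | h <;> linarith
  obtain ⟨v, hv⟩ := exists_corner J w
  have hm : h (pt2 v) ∈ box J' w' :=
    hb ▸ Set.mem_image_of_mem _ (hv.mem_box rfl one_le_two le_rfl)
  have f1 := h.qd_map (pt2 v) (pt1 w)
  have f2 := h.qd_map (pt2 v) (pt2 w)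
  have hq := (h (pt2 v)).pos
  have := hm.2.2.1
  rw [qd, qd, hv.dist_sq, x1, t1, hn1] at f1
  rw [qd, qd, hv.dist_sq, x2, t2, hn1] at f2
  simp only at f1 f2
  field_simp at f1 f2
  nlinarith

/-! ### Symmetries of the prototile -/

theorem prototile_eq_box : prototile d = box Finset.univ 0 := by
  ext p
  simp [prototile, box]

theorem sq_units (ε : ℤˣ) : (((ε : ℤ) : ℝ)) * ((ε : ℤ) : ℝ) = 1 := by
  rcases Int.units_eq_one_or ε with rfl | rfl <;> simp

theorem abs_units (ε : ℤˣ) : |(((ε : ℤ) : ℝ))| = 1 := by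
  rcases Int.units_eq_one_or ε with rfl | rfl <;> simp

theorem facet_c_eq_box (i : Fin d) (ε : ℤˣ) :
    facet (.c i ε) = box (Finset.univ.erase i) (EuclideanSpace.single i ((ε : ℤ) : ℝ)) := by
  ext p
  simp only [facet, prototile, box, Set.mem_ofPred_eq, Finset.mem_erase, Finset.mem_univ, and_true]
  constructor
  · rintro ⟨⟨h1, h2, h3⟩, h4⟩
    refine ⟨fun j hj => by simpa [hj] using h1 j, fun j hj => ?_, h2, h3⟩
    obtain rfl : j = i := by simpa using hj
    simpa using h4
  · rintro ⟨h1, h2, h3, h4⟩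
    have h5 : p.x i = ((ε : ℤ) : ℝ) := by simpa using h2 i (by simp)
    refine ⟨⟨fun j => ?_, h3, h4⟩, h5⟩
    by_cases hj : j = i
    · subst hj
      rw [h5, abs_units]
    · simpa [hj] using h1 j hj

theorem image_eq_of_mem_iff (h : HIsom d) {S S' : Set (HSpace d)} (hS : ∀ p, p ∈ S ↔ h p ∈ S') :
    h '' S = S' := by
  ext q
  rw [h.mem_image, hS, h.apply_symm]

theorem mem_iff_of_image_eq (h : HIsom d) {S S' : Set (HSpace d)} (hS : h '' S = S')
    (p : HSpace d) : p ∈ S ↔ h p ∈ S' := by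
  rw [← hS, h.mem_image, h.symm_apply]

/-- An isometry that preserves heights and the axis over the origin is given by a linear one. -/
theorem exists_linear (h : HIsom d) (ht : ∀ p, (h p).t = p.t)
    {w : EuclideanSpace ℝ (Fin d)} (h0 : (h (pt1 0)).x = w) :
    ∃ A : EuclideanSpace ℝ (Fin d) ≃ₗᵢ[ℝ] EuclideanSpace ℝ (Fin d),
      ∀ p, h p = ⟨A p.x + w, p.t, p.pos⟩ := by
  obtain ⟨φ, hφ⟩ := exists_isometryEquiv h ht
  have h1 : φ 0 = w := by rw [← h0, hφ]
  let ψ := φ.trans (IsometryEquiv.addRight (-w))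
  have h2 : ψ 0 = 0 := by simp [ψ, h1]
  refine ⟨ψ.toRealLinearIsometryEquivOfMapZero h2, fun p => ?_⟩
  rw [hφ]
  ext1
  · simp [ψ]
  · rfl

theorem t_eq_of_symmetry (hd : 1 ≤ d) (h : HIsom d) (hB : h '' prototile d = prototile d) :
    (∀ p, (h p).t = p.t) ∧ (h (pt1 0)).x = 0 := by
  rw [prototile_eq_box] at hB
  obtain ⟨h1, h2⟩ := axis_map_eq (by simpa using hd) rfl h hB
  exact ⟨t_eq_of_vertical h h1 h2, by rw [h1]⟩

theorem linear_of_symmetry (hd : 1 ≤ d) (h : HIsom d) (hB : h '' prototile d = prototile d) :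
    ∃ A : EuclideanSpace ℝ (Fin d) ≃ₗᵢ[ℝ] EuclideanSpace ℝ (Fin d),
      (∀ p, h p = ⟨A p.x, p.t, p.pos⟩) ∧ ∀ x, (∀ i, |x i| ≤ 1) ↔ ∀ i, |A x i| ≤ 1 := by
  obtain ⟨ht, h0⟩ := t_eq_of_symmetry hd h hB
  obtain ⟨A, hA⟩ := exists_linear h ht h0
  refine ⟨A, fun p => by simpa using hA p, fun x => ?_⟩
  have := mem_iff_of_image_eq h hB (pt1 x)
  rw [hA] at this
  simpa [prototile] using this

theorem inner_single_right (x : EuclideanSpace ℝ (Fin d)) (i : Fin d) :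
    inner ℝ x (EuclideanSpace.single i 1) = x i := by
  simp [EuclideanSpace.inner_single_right]

/-- A linear isometry that preserves the cube is a signed permutation of the coordinates. -/
theorem signed_perm (A : EuclideanSpace ℝ (Fin d) ≃ₗᵢ[ℝ] EuclideanSpace ℝ (Fin d))
    (hA : ∀ x, (∀ i, |x i| ≤ 1) → ∀ i, |A x i| ≤ 1) :
    ∃ (π : Equiv.Perm (Fin d)) (ε : Fin d → ℤˣ), ∀ x i, A x i = ((ε i : ℤ) : ℝ) * x (π i) := by
  classical
  -- A corner has squared norm `d`, the largest in the cube, so its image is a corner.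
  have hcor : ∀ c : EuclideanSpace ℝ (Fin d), (∀ i, |c i| = 1) → ∀ i, |A c i| = 1 := by
    intro c hc i
    have h1 : ∀ i, (A c i) ^ 2 ≤ 1 := fun i => by
      have := hA c (fun i => (hc i).le) i
      rwa [sq_le_one_iff_abs_le_one]
    have h2 : ∑ i, (A c i) ^ 2 = ∑ i : Fin d, (1 : ℝ) := by
      have e : ‖A c‖ ^ 2 = ‖c‖ ^ 2 := by rw [A.norm_map]
      rw [EuclideanSpace.real_norm_sq_eq, EuclideanSpace.real_norm_sq_eq] at e
      rw [e]
      refine Finset.sum_congr rfl fun i _ => ?_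
      rw [← sq_abs, hc, one_pow]
    have h3 := (Finset.sum_eq_sum_iff_of_le fun i _ => h1 i).1 h2 i (Finset.mem_univ i)
    simpa using (sq_eq_sq_iff_abs_eq_abs (A c i) 1).1 (by simpa using h3)
  have hcoord : ∀ x i, A x i = ∑ j, x j * A.symm (EuclideanSpace.single i 1) j := by
    intro x i
    rw [← inner_single_right (A x) i, ← A.symm.inner_map_map, A.symm_apply_apply,
      PiLp.inner_apply]
    exact Finset.sum_congr rfl fun j _ => by simp [mul_comm]
  have key : ∀ i, ∃ (j : Fin d) (ε : ℤˣ), ∀ x, A x i = ((ε : ℤ) : ℝ) * x j := by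
    intro i
    set y := A.symm (EuclideanSpace.single i 1) with hy
    let sg : Fin d → ℝ := fun j => if 0 ≤ y j then 1 else -1
    have hsg : ∀ j, |sg j| = 1 := fun j => by by_cases h : 0 ≤ y j <;> simp [sg, h]
    have hsy : ∀ j, sg j * y j = |y j| := fun j => by
      by_cases h : 0 ≤ y j
      · simp [sg, h, abs_of_nonneg]
      · simp [sg, h, abs_of_neg (not_le.1 h)]
    have hsum : ∑ j, |y j| = 1 := by
      have := hcor (WithLp.toLp 2 sg) (fun j => hsg j) i
      rw [hcoord] at this
      simp only [← hy, hsy] at this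
      rwa [abs_of_nonneg (Finset.sum_nonneg fun j _ => abs_nonneg _)] at this
    -- Evaluating row `y` of `A` at the corner with the signs of `y` gives `∑ |y j| = 1`. Flipping
    -- one sign gives `1 - 2 |y j|`, again of absolute value 1, so `|y j|` is 0 or 1.
    have hflip : ∀ j, abs (1 - 2 * |y j|) = 1 := by
      intro j
      have := hcor (WithLp.toLp 2 fun l => if l = j then - sg l else sg l)
        (fun l => by by_cases h : l = j <;> simp [h, hsg]) i
      rw [hcoord] at this
      rw [← hy, ← Finset.add_sum_erase _ _ (Finset.mem_univ j)] at this
      rw [← Finset.add_sum_erase _ _ (Finset.mem_univ j)] at hsum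
      have e : ∑ x ∈ Finset.univ.erase j, (if x = j then - sg x else sg x) * y x =
          ∑ x ∈ Finset.univ.erase j, |y x| :=
        Finset.sum_congr rfl fun l hl => by rw [if_neg (Finset.ne_of_mem_erase hl), hsy]
      simp only [if_true, e, neg_mul, hsy] at this
      rw [← this]
      congr 1
      linarith
    obtain ⟨j, hj⟩ : ∃ j, |y j| ≠ 0 := by
      by_contra! h
      simp [h] at hsum
    have hj1 : |y j| = 1 := by
      rcases (abs_eq one_pos.le).1 (hflip j) with h | h
      · exact absurd (by linarith) hj
      · linarith
    have h0 : ∀ l, l ≠ j → y l = 0 := by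
      intro l hl
      rw [← Finset.add_sum_erase _ _ (Finset.mem_univ j), hj1, add_eq_left] at hsum
      exact abs_eq_zero.1 ((Finset.sum_eq_zero_iff_of_nonneg fun i _ => abs_nonneg _).1 hsum l
        (Finset.mem_erase.2 ⟨hl, Finset.mem_univ l⟩))
    have hx : ∀ x, A x i = y j * x j := by
      intro x
      rw [hcoord, ← hy, Finset.sum_eq_single j (fun l _ hl => by rw [h0 l hl, mul_zero])
        (fun h => absurd (Finset.mem_univ j) h), mul_comm]
    rcases (abs_eq one_pos.le).1 hj1 with h | h
    · exact ⟨j, 1, fun x => by rw [hx, h]; simp⟩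
    · exact ⟨j, -1, fun x => by rw [hx, h]; simp⟩
  choose π ε h using key
  have hπ : Function.Surjective π := by
    intro j
    obtain ⟨i, hi⟩ : ∃ i, A (EuclideanSpace.single j 1) i ≠ 0 := by
      by_contra! h0
      have : A (EuclideanSpace.single j 1) = 0 := by ext i; simpa using h0 i
      rw [map_eq_zero_iff A A.injective] at this
      have := congrArg (fun x : EuclideanSpace ℝ (Fin d) => x j) this
      simp at this
    refine ⟨i, ?_⟩
    by_contra hne
    rw [h] at hi
    simp [hne] at hi
  exact ⟨Equiv.ofBijective π (Finite.injective_iff_bijective.1 (Finite.injective_iff_surjective.2 hπ)),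
    ε, fun x i => h i x⟩

theorem image_facet_a_of_symmetry (hd : 1 ≤ d) (h : HIsom d)
    (hB : h '' prototile d = prototile d) : h '' facet .a = facet .a := by
  refine image_eq_of_mem_iff h fun p => ?_
  simp only [facet, Set.mem_ofPred_eq, ← mem_iff_of_image_eq h hB, (t_eq_of_symmetry hd h hB).1]

theorem exists_signed_perm (hd : 1 ≤ d) (h : HIsom d) (hB : h '' prototile d = prototile d) :
    ∃ (π : Equiv.Perm (Fin d)) (ε : Fin d → ℤˣ),
      ∀ p i, (h p).x i = ((ε i : ℤ) : ℝ) * p.x (π i) := by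
  obtain ⟨A, hA, hc⟩ := linear_of_symmetry hd h hB
  obtain ⟨π, ε, hπ⟩ := signed_perm A fun x => (hc x).1
  exact ⟨π, ε, fun p i => by rw [hA, hπ]⟩

/-- The symmetries of the prototile permute its facets. -/
theorem exists_image_facet (hd : 1 ≤ d) (h : HIsom d) (hB : h '' prototile d = prototile d)
    (f : FacetName d) : ∃ f', h '' facet f = facet f' := by
  obtain ⟨π, ε, hπ⟩ := exists_signed_perm hd h hB
  cases f with
  | a => exact ⟨.a, image_facet_a_of_symmetry hd h hB⟩
  | b σ =>
    refine ⟨.b fun i => ε i * σ (π i), image_eq_of_mem_iff h fun p => ?_⟩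
    have e : ∀ i, (h p).x i * (((ε i * σ (π i) : ℤˣ) : ℤ) : ℝ) =
        p.x (π i) * ((σ (π i) : ℤ) : ℝ) := by
      intro i
      rw [hπ]
      push_cast
      linear_combination (p.x (π i) * ((σ (π i) : ℤ) : ℝ)) * sq_units (ε i)
    simp only [facet, Set.mem_ofPred_eq, ← mem_iff_of_image_eq h hB, (t_eq_of_symmetry hd h hB).1, e]
    refine and_congr_right fun _ => and_congr_right fun _ => ⟨fun H i => H (π i), fun H i => ?_⟩
    simpa using H (π.symm i)
  | c j δ =>
    refine ⟨.c (π.symm j) (ε (π.symm j) * δ), image_eq_of_mem_iff h fun p => ?_⟩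
    simp only [facet, Set.mem_ofPred_eq, ← mem_iff_of_image_eq h hB, hπ, Equiv.apply_symm_apply]
    refine and_congr_right fun _ => ?_
    push_cast
    refine ⟨fun h => by rw [h], fun h => ?_⟩
    have := congrArg (fun x => ((ε (π.symm j) : ℤ) : ℝ) * x) h
    simpa only [← mul_assoc, sq_units, one_mul] using this

/-! ### Isometries between faces -/

/-- A vertical segment is not isometric to a subset of a horosphere `t = t₀`. -/
theorem not_vertical_to_horosphere (h : HIsom d) (x : EuclideanSpace ℝ (Fin d)) {t₀ : ℝ}
    (ht : ∀ p : HSpace d, p.x = x → 1 ≤ p.t → p.t ≤ 2 → (h p).t = t₀) : False := by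
  -- Heights in geometric progression, so that consecutive pairs both have `qd = 1/12` while the
  -- outer pair has `49/144`. On a horosphere the triangle inequality allows at most `4/12 =
  -- 48/144`.
  let p1 : HSpace d := ⟨x, 1, by norm_num⟩
  let p2 : HSpace d := ⟨x, 4 / 3, by norm_num⟩
  let p3 : HSpace d := ⟨x, 16 / 9, by norm_num⟩
  have t1 := ht p1 rfl (by norm_num [p1]) (by norm_num [p1])
  have t2 := ht p2 rfl (by norm_num [p2]) (by norm_num [p2])
  have t3 := ht p3 rfl (by norm_num [p3]) (by norm_num [p3])
  have hpos : 0 < t₀ := t1 ▸ (h p1).pos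
  have e12 := h.qd_map p1 p2
  have e23 := h.qd_map p2 p3
  have e13 := h.qd_map p1 p3
  have tri := dist_triangle (h p1).x (h p2).x (h p3).x
  have n12 := dist_nonneg (x := (h p1).x) (y := (h p2).x)
  have n23 := dist_nonneg (x := (h p2).x) (y := (h p3).x)
  have n13 := dist_nonneg (x := (h p1).x) (y := (h p3).x)
  simp only [qd, t1, t2, t3, p1, p2, p3, dist_self] at e12 e23 e13
  rw [div_eq_iff (by positivity)] at e12 e23 e13
  norm_num at e12 e23 e13
  change dist (h p1).x (h p2).x ^ 2 = _ at e12
  change dist (h p2).x (h p3).x ^ 2 = _ at e23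
  change dist (h p1).x (h p3).x ^ 2 = _ at e13
  have h1 := pow_le_pow_left₀ n13 tri 2
  nlinarith [sq_nonneg (dist (h p1).x (h p2).x - dist (h p2).x (h p3).x), mul_pos hpos hpos]

/-- The facet lies in a horosphere centred at `∞`. -/
def FacetName.IsHoro (f : FacetName d) : Prop := f = .a ∨ ∃ σ, f = .b σ

theorem FacetName.IsHoro.exists_height {f : FacetName d} (hf : f.IsHoro) :
    ∃ t₀, ∀ p ∈ facet f, p.t = t₀ := by
  rcases hf with rfl | ⟨σ, rfl⟩
  · exact ⟨2, fun p hp => hp.2⟩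
  · exact ⟨1, fun p hp => hp.2.1⟩

theorem sub_sq_le_one {x y : ℝ} {σ : ℤˣ} (hx : |x| ≤ 1) (hy : |y| ≤ 1)
    (hx' : 0 ≤ x * ((σ : ℤ) : ℝ)) (hy' : 0 ≤ y * ((σ : ℤ) : ℝ)) : (x - y) ^ 2 ≤ 1 := by
  have h1 := abs_le.1 hx
  have h2 := abs_le.1 hy
  rcases Int.units_eq_one_or σ with rfl | rfl <;> simp at hx' hy' <;> nlinarith

theorem sub_sq_eq_of_qd_a {p q : HSpace d} (hp : p ∈ facet .a) (hq : q ∈ facet .a)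
    (h : qd p q = d) (i : Fin d) : (p.x i - q.x i) ^ 2 = 4 := by
  rw [qd, hp.2, hq.2, dist_sq_eq, div_eq_iff (by norm_num)] at h
  have h4 : ∀ i ∈ Finset.univ, (p.x i - q.x i) ^ 2 ≤ 4 := by
    intro i _
    have h1 := abs_le.1 (hp.1.1 i)
    have h2 := abs_le.1 (hq.1.1 i)
    nlinarith
  refine (Finset.sum_eq_sum_iff_of_le h4).1 ?_ i (Finset.mem_univ i)
  simp only [Finset.sum_const, nsmul_eq_mul, Finset.card_univ, Fintype.card_fin]
  linarith

theorem sub_sq_eq_of_qd_b {σ : Fin d → ℤˣ} {p q : HSpace d} (hp : p ∈ facet (.b σ))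
    (hq : q ∈ facet (.b σ)) (h : qd p q = d) (i : Fin d) : (p.x i - q.x i) ^ 2 = 1 := by
  rw [qd, hp.2.1, hq.2.1, dist_sq_eq, div_eq_iff (by norm_num)] at h
  have h4 : ∀ i ∈ Finset.univ, (p.x i - q.x i) ^ 2 ≤ 1 := fun i _ =>
    sub_sq_le_one (hp.1.1 i) (hq.1.1 i) (hp.2.2 i) (hq.2.2 i)
  refine (Finset.sum_eq_sum_iff_of_le h4).1 ?_ i (Finset.mem_univ i)
  simp only [Finset.sum_const, nsmul_eq_mul, Finset.card_univ, Fintype.card_fin]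
  linarith

/-- The vertex of the cube with signs `σ`. -/
noncomputable def signVec (σ : Fin d → ℤˣ) : EuclideanSpace ℝ (Fin d) :=
  WithLp.toLp 2 fun i => ((σ i : ℤ) : ℝ)

@[simp] theorem signVec_apply (σ : Fin d → ℤˣ) (i : Fin d) :
    signVec σ i = ((σ i : ℤ) : ℝ) := rfl

theorem sum_signVec_sq (σ : Fin d → ℤˣ) : ∑ i, (signVec σ i) ^ 2 = d := by
  simp [pow_two, sq_units]

/-- Both kinds of horospherical facet are intrinsically unit cubes, and `d` is the squared diameter.
-/
theorem exists_qd_eq {f : FacetName d} (hf : f.IsHoro) :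
    ∃ p ∈ facet f, ∃ q ∈ facet f, qd p q = d := by
  rcases hf with rfl | ⟨σ, rfl⟩
  · refine ⟨pt2 (signVec 1), ?_, pt2 (-signVec 1), ?_, ?_⟩
    · simp [facet, prototile]
    · simp [facet, prototile]
    · rw [qd, dist_sq_eq]
      simp
      norm_num
  · refine ⟨pt1 (signVec σ), ?_, pt1 0, ?_, ?_⟩
    · simp [facet, prototile, abs_units, sq_units]
    · simp [facet, prototile]
    · rw [qd, dist_sq_eq]
      simpa using sum_signVec_sq σ

/-- The ends of a diagonal differ in every coordinate, whereas a `c`-facet, or the intersection of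
two `b`-facets, has a constant coordinate. -/
theorem eq_of_diametral_mem {f f' : FacetName d} (hf : f.IsHoro) {p q : HSpace d}
    (h : qd p q = d) (hp : p ∈ facet f) (hq : q ∈ facet f) (hp' : p ∈ facet f')
    (hq' : q ∈ facet f') : f' = f := by
  have hc : ∀ i, (p.x i - q.x i) ^ 2 ≠ 0 := by
    intro i
    rcases hf with rfl | ⟨σ, rfl⟩
    · rw [sub_sq_eq_of_qd_a hp hq h]; norm_num
    · rw [sub_sq_eq_of_qd_b hp hq h]; norm_num
  cases f' with
  | c i ε => exact absurd (by rw [hp'.2, hq'.2]; ring) (hc i)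
  | a =>
    rcases hf with rfl | ⟨σ, rfl⟩
    · rfl
    · have h1 := hp'.2
      have h2 := hp.2.1
      linarith
  | b τ =>
    rcases hf with rfl | ⟨σ, rfl⟩
    · have h1 := hp'.2.1
      have h2 := hp.2
      linarith
    · congr 1
      funext i
      by_contra hne
      have hz : ∀ r : HSpace d, r ∈ facet (.b τ) → r ∈ facet (.b σ) → r.x i = 0 := by
        intro r h1 h2
        have a1 := h1.2.2 i
        have a2 := h2.2.2 i
        rcases Int.units_eq_one_or (τ i) with e | e <;>
          rcases Int.units_eq_one_or (σ i) with e' | e' <;> simp [e, e'] at a1 a2 hne <;> linarith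
      exact hc i (by rw [hz p hp' hp, hz q hq' hq]; ring)

theorem biInter_eq_of_forall_eq {S : Set (FacetName d)} {f : FacetName d} (hf : f ∈ S)
    (h : ∀ f' ∈ S, f' = f) : ⋂ f ∈ S, facet f = facet f := by
  have : S = {f} := Set.eq_singleton_iff_unique_mem.2 ⟨hf, h⟩
  rw [this]; simp

/-- A face that is isometric to an `a`- or `b`-facet is an `a`- or `b`-facet. -/
theorem exists_horo_facet (h : HIsom d) {f : FacetName d} (hf : f.IsHoro)
    {S : Set (FacetName d)} (he : h '' facet f = ⋂ f ∈ S, facet f) :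
    ∃ f' : FacetName d, f'.IsHoro ∧ h '' facet f = facet f' := by
  obtain ⟨p, hp, q, hq, hpq⟩ := exists_qd_eq hf
  have hsub : ∀ r ∈ facet f, ∀ f' ∈ S, h r ∈ facet f' := by
    intro r hr f' hf'
    have : h r ∈ ⋂ f ∈ S, facet f := he ▸ Set.mem_image_of_mem _ hr
    exact Set.mem_iInter₂.1 this f' hf'
  by_cases hex : ∃ f' ∈ S, f'.IsHoro
  · obtain ⟨f', hf', hh⟩ := hex
    refine ⟨f', hh, he.trans (biInter_eq_of_forall_eq hf' fun f'' hf'' => ?_)⟩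
    exact eq_of_diametral_mem hh ((h.qd_map p q).trans hpq) (hsub p hp f' hf')
      (hsub q hq f' hf') (hsub p hp f'' hf'') (hsub q hq f'' hf'')
  · exfalso
    -- An intersection of `c`-facets alone contains the whole vertical segment through `h p`, which
    -- `h.symm` would carry into a horosphere.
    obtain ⟨t₀, ht₀⟩ := hf.exists_height
    refine not_vertical_to_horosphere h.symm (h p).x (t₀ := t₀) fun r hr h1 h2 => ht₀ _ ?_
    rw [← h.mem_image, he]
    refine Set.mem_iInter₂.2 fun f' hf' => ?_
    have := hsub p hp f' hf'
    cases f' with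
    | a => exact absurd ⟨_, hf', Or.inl rfl⟩ hex
    | b σ => exact absurd ⟨_, hf', Or.inr ⟨σ, rfl⟩⟩ hex
    | c i ε => exact ⟨⟨fun j => by rw [hr]; exact this.1.1 j, h1, h2⟩, by rw [hr]; exact this.2⟩

/-- A face that is isometric to a `c`-facet is a `c`-facet. -/
theorem exists_c_facet (h : HIsom d) {i : Fin d} {ε : ℤˣ}
    {S : Set (FacetName d)} (hS : S.Nonempty) (he : h '' facet (.c i ε) = ⋂ f ∈ S, facet f) :
    ∃ j δ, h '' facet (.c i ε) = facet (.c j δ) := by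
  have hsub : ∀ r ∈ facet (.c i ε), ∀ f' ∈ S, h r ∈ facet f' := by
    intro r hr f' hf'
    have : h r ∈ ⋂ f ∈ S, facet f := he ▸ Set.mem_image_of_mem _ hr
    exact Set.mem_iInter₂.1 this f' hf'
  have hno : ∀ f' ∈ S, ¬ f'.IsHoro := by
    intro f' hf' hh
    obtain ⟨t₀, ht₀⟩ := hh.exists_height
    refine not_vertical_to_horosphere h (EuclideanSpace.single i ((ε : ℤ) : ℝ)) (t₀ := t₀)
      fun r hr h1 h2 => ht₀ _ (hsub r ?_ f' hf')
    rw [facet_c_eq_box, ← hr]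
    exact axis_mem_box h1 h2
  obtain ⟨f', hf'⟩ := hS
  cases f' with
  | a => exact absurd (Or.inl rfl) (hno _ hf')
  | b σ => exact absurd (Or.inr ⟨σ, rfl⟩) (hno _ hf')
  | c j δ =>
    refine ⟨j, δ, he.trans (biInter_eq_of_forall_eq hf' fun f'' hf'' => ?_)⟩
    cases f'' with
    | a => exact absurd (Or.inl rfl) (hno _ hf'')
    | b σ => exact absurd (Or.inr ⟨σ, rfl⟩) (hno _ hf'')
    | c k τ =>
      obtain ⟨v, hv⟩ := exists_corner (Finset.univ.erase i)
        (EuclideanSpace.single i ((ε : ℤ) : ℝ))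
      have hp : pt1 v ∈ facet (.c i ε) := by
        rw [facet_c_eq_box]; exact hv.mem_box rfl le_rfl one_le_two
      by_cases hkj : k = j
      · subst hkj
        have h1 := (hsub _ hp _ hf').2
        have h2 := (hsub _ hp _ hf'').2
        rw [h1] at h2
        have : δ = τ := Units.ext (Int.cast_injective (α := ℝ) h2)
        rw [this]
      -- Antipodal bottom corners of the source go to antipodal bottom corners of the facet `c j δ`.
      -- Their `k`-th coordinates are opposite, so they cannot both equal `τ`.
      · exfalso
        have hq : pt1 ((2 : ℝ) • EuclideanSpace.single i ((ε : ℤ) : ℝ) - v) ∈ facet (.c i ε) := by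
          rw [facet_c_eq_box]; exact hv.antipode.mem_box rfl le_rfl one_le_two
        have hcard : ∀ l : Fin d, (Finset.univ.erase l).card = d - 1 := fun l => by simp
        have h1 := hsub _ hp _ hf'
        have h2 := hsub _ hq _ hf'
        have h1' := (hsub _ hp _ hf'').2
        have h2' := (hsub _ hq _ hf'').2
        rw [facet_c_eq_box] at h1 h2
        have hJ : 1 ≤ (Finset.univ.erase j).card :=
          Finset.card_pos.2 ⟨k, Finset.mem_erase.2 ⟨hkj, Finset.mem_univ k⟩⟩
        have hqd : qd (h (pt1 v)) (h (pt1 ((2 : ℝ) • EuclideanSpace.single i ((ε : ℤ) : ℝ) - v)))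
            = 4 * (Finset.univ.erase j).card := by
          rw [h.qd_map, hcard, ← hcard i, ← hv.dist_sq]
          have : v - ((2 : ℝ) • EuclideanSpace.single i ((ε : ℤ) : ℝ) - v) =
            (2 : ℝ) • (v - EuclideanSpace.single i ((ε : ℤ) : ℝ)) := by module
          simp only [qd, dist_eq_norm, this, norm_smul]
          norm_num
          ring
        obtain ⟨-, -, e⟩ := corner_of_diametral hJ h1 h2 hqd
        rw [e] at h2'
        simp [hkj, h1'] at h2'
        rcases Int.units_eq_one_or τ with rfl | rfl <;> norm_num at h2'

/-! ### Isometries that preserve the `a`-facet -/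

/-- On `t = 2` distances are Euclidean, so the image of the centre of the facet is the midpoint of
the images of `±u`. By the parallelogram law, combining the `qd` equations for these three points
eliminates the horizontal distance and leaves `‖u‖²` times a difference of heights. -/
theorem t_eq_of_image_facet_a (hd : 1 ≤ d) (h : HIsom d) (ha : h '' facet .a = facet .a)
    (p : HSpace d) : (h p).t = p.t := by
  have hmem : ∀ x : EuclideanSpace ℝ (Fin d), (∀ i, |x i| ≤ 1) →
      h (pt2 x) = pt2 (h (pt2 x)).x := by
    intro x hx
    have : h (pt2 x) ∈ facet .a := ha ▸ Set.mem_image_of_mem _ ⟨⟨hx, one_le_two, le_rfl⟩, rfl⟩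
    exact HSpace.ext rfl this.2
  have hdist : ∀ x y : EuclideanSpace ℝ (Fin d), (∀ i, |x i| ≤ 1) → (∀ i, |y i| ≤ 1) →
      dist (h (pt2 x)).x (h (pt2 y)).x = dist x y := by
    intro x y hx hy
    have e := h.qd_map (pt2 x) (pt2 y)
    rw [hmem x hx, hmem y hy] at e
    simp only [qd, sub_self] at e
    field_simp at e
    rw [← pow_left_inj₀ dist_nonneg dist_nonneg two_ne_zero]
    linarith
  set u : EuclideanSpace ℝ (Fin d) := signVec 1 with hu
  have hu1 : ∀ i, |u i| ≤ 1 := fun i => by simp [hu]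
  have hu2 : ∀ i, |(-u) i| ≤ 1 := fun i => by simp [hu]
  have hu0 : ∀ i, |(0 : EuclideanSpace ℝ (Fin d)) i| ≤ 1 := fun i => by simp
  set x₀ := (h (pt2 0)).x with hx0
  set x₁ := (h (pt2 u)).x with hx1
  set x₂ := (h (pt2 (-u))).x with hx2
  have d1 : dist x₁ x₀ = ‖u‖ := by rw [hx0, hx1, hdist _ _ hu1 hu0, dist_zero_right]
  have d2 : dist x₀ x₂ = ‖u‖ := by rw [hx0, hx2, hdist _ _ hu0 hu2, dist_zero_left, norm_neg]
  have d3 : dist x₁ x₂ = 2 * ‖u‖ := by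
    rw [hx1, hx2, hdist _ _ hu1 hu2, dist_eq_norm, sub_neg_eq_add, ← two_smul ℝ u, norm_smul]
    simp
  have hmid : x₀ = midpoint ℝ x₁ x₂ := by
    apply eq_midpoint_of_dist_eq_half
    · rw [d1, d3]; ring
    · rw [d2, d3]; ring
  have hpos : 0 < ‖u‖ := by
    rw [norm_pos_iff]
    intro h0
    have := congrArg (fun x : EuclideanSpace ℝ (Fin d) => x ⟨0, hd⟩) h0
    simp [hu] at this
  have par : ∀ y x w : EuclideanSpace ℝ (Fin d),
      dist y (x + w) ^ 2 + dist y (x - w) ^ 2 = 2 * dist y x ^ 2 + 2 * ‖w‖ ^ 2 := by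
    intro y x w
    have := parallelogram_law_with_norm ℝ (y - x) w
    rw [dist_eq_norm, dist_eq_norm, dist_eq_norm, show y - (x + w) = y - x - w by abel,
      show y - (x - w) = y - x + w by abel]
    linarith
  have key : dist (h p).x x₁ ^ 2 + dist (h p).x x₂ ^ 2 =
      2 * dist (h p).x x₀ ^ 2 + 2 * ‖u‖ ^ 2 := by
    have hh : x₁ = x₀ + (x₁ - x₀) := by abel
    have hh' : x₂ = x₀ - (x₁ - x₀) := by
      have : x₁ + x₂ = (2 : ℝ) • x₀ := by
        rw [hmid, midpoint_eq_smul_add, smul_smul]; norm_num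
      rw [two_smul] at this
      rw [eq_sub_iff_add_eq'.2 this]
      abel
    have := par (h p).x x₀ (x₁ - x₀)
    rw [← hh, ← hh', ← dist_eq_norm, d1] at this
    exact this
  have key' := par p.x 0 u
  rw [zero_add, zero_sub] at key'
  have e0 := h.qd_map p (pt2 0)
  have e1 := h.qd_map p (pt2 u)
  have e2 := h.qd_map p (pt2 (-u))
  rw [hmem _ hu0] at e0
  rw [hmem _ hu1] at e1
  rw [hmem _ hu2] at e2
  rw [← hx0] at e0
  rw [← hx1] at e1
  rw [← hx2] at e2
  have hp := p.pos
  have hq := (h p).pos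
  simp only [qd] at e0 e1 e2
  field_simp at e0 e1 e2
  have hu3 : ‖u‖ ^ 2 ≠ 0 := by positivity
  have : ‖u‖ ^ 2 * ((h p).t - p.t) = 0 := by
    linear_combination (-(1 / 2 : ℝ)) * e1 - (1 / 2 : ℝ) * e2 + e0 + (1 / 2 : ℝ) * p.t * key -
      (1 / 2 : ℝ) * (h p).t * key'
  rcases mul_eq_zero.1 this with h | h
  · exact absurd h hu3
  · linarith

/-- The facet fixes the base cube, and preservation of heights fixes the side on which the tile
lies. This rigidity identifies the neighbours across horospherical facets. -/
theorem image_prototile_of_image_facet_a (hd : 1 ≤ d) (h : HIsom d)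
    (ha : h '' facet .a = facet .a) : h '' prototile d = prototile d := by
  have ht := t_eq_of_image_facet_a hd h ha
  refine image_eq_of_mem_iff h fun p => ?_
  have hx : (h (pt2 p.x)).x = (h p).x := by
    have := dist_eq_of_t_eq h ht (pt2 p.x) p
    simpa using this
  have := mem_iff_of_image_eq h ha (pt2 p.x)
  simp only [facet, prototile, Set.mem_ofPred_eq, ht, hx] at this ⊢
  norm_num at this
  rw [this]

/-! ### Tilings: transport and local structure -/

/-- The conditions on a Böröczky tiling that do not refer to the topology. -/
structure IsTil (𝒯 : Set (Set (HSpace d))) : Prop where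
  copy : ∀ T ∈ 𝒯, IsCopy T
  cover : ∀ p, ∃ T ∈ 𝒯, p ∈ T
  face_to_face : ∀ T ∈ 𝒯, ∀ T' ∈ 𝒯, T ≠ T' → (T ∩ T').Nonempty →
    IsFace T (T ∩ T') ∧ IsFace T' (T ∩ T')
  oriented : d = 1 → ∀ T ∈ 𝒯, ∀ T' ∈ 𝒯, ∀ F A A' : Set (HSpace d),
    IsCFacet T F → IsCFacet T' F → IsAFacet T A → IsAFacet T' A' → F ∩ A = F ∩ A'

theorem IsBTiling.isTil {𝒯 : Set (Set (HSpace d))} (h : IsBTiling 𝒯) : IsTil 𝒯 where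
  copy := h.copy
  cover p := by
    have : p ∈ ⋃₀ 𝒯 := h.cover ▸ Set.mem_univ p
    exact this
  face_to_face := h.face_to_face
  oriented := h.oriented

theorem IsFace.image {T F : Set (HSpace d)} (h : IsFace T F) (g : HIsom d) :
    IsFace (g '' T) (g '' F) := by
  obtain ⟨g', rfl, S, h1, h2, rfl⟩ := h
  exact ⟨g.comp g', by rw [g.comp_image], S, h1, h2, by rw [g.comp_image]⟩

theorem IsAFacet.image {T F : Set (HSpace d)} (h : IsAFacet T F) (g : HIsom d) :
    IsAFacet (g '' T) (g '' F) := by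
  obtain ⟨g', rfl, rfl⟩ := h
  exact ⟨g.comp g', by rw [g.comp_image], by rw [g.comp_image]⟩

theorem IsCFacet.image {T F : Set (HSpace d)} (h : IsCFacet T F) (g : HIsom d) :
    IsCFacet (g '' T) (g '' F) := by
  obtain ⟨g', rfl, i, ε, rfl⟩ := h
  exact ⟨g.comp g', by rw [g.comp_image], i, ε, by rw [g.comp_image]⟩

theorem IsTil.preimage {𝒯 : Set (Set (HSpace d))} (h : IsTil 𝒯) (g : HIsom d) :
    IsTil {T | g '' T ∈ 𝒯} where
  copy T hT := by
    obtain ⟨g', hg'⟩ := h.copy _ hT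
    exact ⟨g.symm.comp g', by rw [g.symm.comp_image, ← hg', g.symm_image_image]⟩
  cover p := by
    obtain ⟨T, hT, hp⟩ := h.cover (g p)
    refine ⟨g.symm '' T, ?_, g p, hp, by simp⟩
    simpa using hT
  face_to_face T hT T' hT' hne hinter := by
    have hi : g '' T ∩ g '' T' = g '' (T ∩ T') := (Set.image_inter g.injective).symm
    obtain ⟨h1, h2⟩ := h.face_to_face _ hT _ hT' (fun e => hne (g.image_injective e))
      (hi ▸ hinter.image _)
    rw [hi] at h1 h2
    exact ⟨by simpa using h1.image g.symm, by simpa using h2.image g.symm⟩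
  oriented hd T hT T' hT' F A A' h1 h2 h3 h4 := by
    have := h.oriented hd _ hT _ hT' _ _ _ (h1.image g) (h2.image g) (h3.image g) (h4.image g)
    rw [← Set.image_inter g.injective, ← Set.image_inter g.injective] at this
    exact g.image_injective this

/-- The interior of the prototile. -/
def openPrototile (d : ℕ) : Set (HSpace d) := {p | (∀ i, |p.x i| < 1) ∧ 1 < p.t ∧ p.t < 2}

theorem not_mem_facet_of_mem_openPrototile {p : HSpace d} (hp : p ∈ openPrototile d)
    (f : FacetName d) : p ∉ facet f := by
  intro h
  obtain ⟨h1, h2, h3⟩ := hp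
  cases f with
  | a => exact h3.ne h.2
  | b σ => exact h2.ne' h.2.1
  | c i ε =>
    have := h1 i
    rw [h.2, abs_units] at this
    exact lt_irrefl _ this

theorem openPrototile_subset : openPrototile d ⊆ prototile d := fun _ h =>
  ⟨fun i => (h.1 i).le, h.2.1.le, h.2.2.le⟩

/-- A face of a tile lies in the image of facets under any parametrization of the tile. -/
theorem IsFace.exists_facets (hd : 1 ≤ d) {g : HIsom d} {F : Set (HSpace d)}
    (h : IsFace (g '' prototile d) F) :
    ∃ S : Set (FacetName d), S.Nonempty ∧ F = g '' ⋂ f ∈ S, facet f := by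
  obtain ⟨g', h1, S, h2, -, rfl⟩ := h
  have hk : g.symm.comp g' '' prototile d = prototile d := by
    rw [HIsom.comp_image, ← h1, g.symm_image_image]
  choose e he using exists_image_facet hd _ hk
  refine ⟨e '' S, h2.image _, ?_⟩
  rw [g'.image_eq_iff, ← g'.image_eq_iff, eq_comm, g.image_eq_iff, ← HIsom.comp_image,
    Set.biInter_image, Set.InjOn.image_biInter_eq h2 (HIsom.injective _).injOn]
  exact Set.iInter₂_congr fun f _ => (he f).symm

/-- Otherwise the intersection would be a face, which lies in a facet, and facets contain no
interior point. -/
theorem IsTil.eq_of_mem_open {𝒯 : Set (Set (HSpace d))} (hd : 1 ≤ d) (h : IsTil 𝒯) {g : HIsom d}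
    {T' : Set (HSpace d)} (hT : g '' prototile d ∈ 𝒯) (hT' : T' ∈ 𝒯) {q : HSpace d}
    (hq : q ∈ openPrototile d) (hq' : g q ∈ T') : g '' prototile d = T' := by
  by_contra hne
  have hm : g q ∈ g '' prototile d ∩ T' :=
    ⟨Set.mem_image_of_mem _ (openPrototile_subset hq), hq'⟩
  obtain ⟨S, ⟨f, hf⟩, hS⟩ := (h.face_to_face _ hT _ hT' hne ⟨_, hm⟩).1.exists_facets hd
  rw [hS, g.mem_image, g.symm_apply] at hm
  exact not_mem_facet_of_mem_openPrototile hq f (Set.mem_iInter₂.1 hm f hf)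

/-! ### Metric bounds, compactness and local finiteness -/

theorem qd_comm (p q : HSpace d) : qd p q = qd q p := by
  rw [qd, qd, dist_comm, mul_comm]; congr 1; ring

theorem bounds_of_qd_le {p q : HSpace d} {M : ℝ} (h : qd p q ≤ M) :
    q.t ≤ (M + 2) * p.t ∧ p.t ≤ (M + 2) * q.t ∧ dist p.x q.x ^ 2 ≤ M * (p.t * q.t) ∧
      (p.t - q.t) ^ 2 ≤ M * (p.t * q.t) := by
  have hp := p.pos
  have hq := q.pos
  rw [qd, div_le_iff₀ (by positivity)] at h
  have := sq_nonneg (dist p.x q.x)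
  have := sq_nonneg (p.t - q.t)
  refine ⟨?_, ?_, by linarith, by linarith⟩
  · refine le_of_mul_le_mul_right ?_ hq
    nlinarith
  · refine le_of_mul_le_mul_right ?_ hp
    nlinarith

theorem abs_sub_apply_le_dist (x y : EuclideanSpace ℝ (Fin d)) (i : Fin d) :
    |x i - y i| ≤ dist x y := by
  refine abs_le_of_sq_le_sq ?_ dist_nonneg
  rw [dist_sq_eq]
  exact Finset.single_le_sum (f := fun i => (x i - y i) ^ 2) (fun i _ => sq_nonneg _)
    (Finset.mem_univ i)

/-- Any small radius would do: tiles whose centres are this close share an interior point and hence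
coincide. -/
theorem mem_openPrototile_of_qd_lt {q : HSpace d}
    (h : qd ⟨0, 3 / 2, by norm_num⟩ q < 1 / 100) : q ∈ openPrototile d := by
  obtain ⟨h1, -, h3, h4⟩ := bounds_of_qd_le h.le
  simp only at h1 h3 h4
  have hq := q.pos
  have h5 : |3 / 2 - q.t| < 1 / 2 := by
    refine abs_lt_of_sq_lt_sq ?_ (by norm_num)
    nlinarith
  have h6 : dist 0 q.x < 1 := by
    refine lt_of_pow_lt_pow_left₀ 2 zero_le_one ?_
    nlinarith
  have h7 := abs_lt.1 h5
  refine ⟨fun i => ?_, by linarith, by linarith⟩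
  have := abs_sub_apply_le_dist 0 q.x i
  simp only [PiLp.zero_apply, zero_sub, abs_neg] at this
  linarith

/-- Closedness of the prototile, expressed through `qd`. -/
theorem mem_prototile_of_approx {p : HSpace d}
    (h : ∀ ρ > 0, ∃ b ∈ prototile d, qd p b < ρ) : p ∈ prototile d := by
  have hp := p.pos
  have key : ∀ η > 0, (∀ i, |p.x i| ≤ 1 + η) ∧ 1 ≤ p.t + η ∧ p.t ≤ 2 + η := by
    intro η hη
    obtain ⟨b, hb, hlt⟩ := h (η ^ 2 / (2 * p.t)) (by positivity)
    obtain ⟨-, -, h3, h4⟩ := bounds_of_qd_le hlt.le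
    have e : η ^ 2 / (2 * p.t) * (p.t * b.t) ≤ η ^ 2 := by
      have : η ^ 2 / (2 * p.t) * (p.t * b.t) = η ^ 2 * (b.t / 2) := by field_simp
      rw [this]
      have := hb.2.2
      exact mul_le_of_le_one_right (by positivity) (by linarith)
    have h5 := abs_le.1 (abs_le_of_sq_le_sq (h4.trans e) hη.le)
    have h6 : dist p.x b.x ≤ η := 
      (pow_le_pow_iff_left₀ dist_nonneg hη.le two_ne_zero).1 (h3.trans e)
    refine ⟨fun i => ?_, by linarith [hb.2.1], by linarith [hb.2.2]⟩
    have h7 := abs_sub_apply_le_dist p.x b.x i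
    have h8 := hb.1 i
    have h9 := abs_sub_abs_le_abs_sub (p.x i) (b.x i)
    linarith
  exact ⟨fun i => le_of_forall_pos_le_add fun η hη => (key η hη).1 i,
    le_of_forall_pos_le_add fun η hη => (key η hη).2.1,
    le_of_forall_pos_le_add fun η hη => (key η hη).2.2⟩

open Filter Topology in
/-- A bounded sequence of points has a subsequence that stays close to its first term. -/
theorem exists_subseq_qd_lt {c : ℕ → HSpace d} {p : HSpace d} {M : ℝ}
    (hM : ∀ n, qd p (c n) ≤ M) {ρ : ℝ} (hρ : 0 < ρ) :
    ∃ φ : ℕ → ℕ, StrictMono φ ∧ ∀ n, qd (c (φ 0)) (c (φ n)) < ρ := by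
  have hp := p.pos
  have hM2 : 0 < M + 2 := by
    by_contra! hneg
    have := (bounds_of_qd_le (hM 0)).1
    have := (c 0).pos
    nlinarith
  set R := Real.sqrt (M * (p.t * ((M + 2) * p.t)))
  set K : Set (EuclideanSpace ℝ (Fin d) × ℝ) :=
    Metric.closedBall p.x R ×ˢ Set.Icc (p.t / (M + 2)) ((M + 2) * p.t)
  have hK : IsCompact K := (isCompact_closedBall _ _).prod isCompact_Icc
  have hM0 : 0 ≤ M := by
    refine le_trans ?_ (hM 0)
    have := (c 0).pos
    unfold qd
    positivity
  have hc : ∀ n, ((c n).x, (c n).t) ∈ K := by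
    intro n
    obtain ⟨h1, h2, h3, -⟩ := bounds_of_qd_le (hM n)
    refine ⟨?_, ?_, h1⟩
    · rw [Metric.mem_closedBall, dist_comm]
      apply Real.le_sqrt_of_sq_le
      refine h3.trans ?_
      gcongr
    · rw [div_le_iff₀ hM2]
      linarith
  obtain ⟨⟨x, t⟩, hxt, φ, hφ, hlim⟩ := hK.tendsto_subseq hc
  have ht : 0 < t := lt_of_lt_of_le (by positivity) hxt.2.1
  have hx1 : Tendsto (fun n => (c (φ n)).x) atTop (𝓝 x) := (continuous_fst.tendsto _).comp hlim
  have ht1 : Tendsto (fun n => (c (φ n)).t) atTop (𝓝 t) := (continuous_snd.tendsto _).comp hlim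
  have hT : Tendsto (fun nm : ℕ × ℕ => qd (c (φ nm.1)) (c (φ nm.2))) (atTop ×ˢ atTop)
      (𝓝 ((dist x x ^ 2 + (t - t) ^ 2) / (t * t))) := by
    have a1 := hx1.comp (tendsto_fst (f := (atTop : Filter ℕ)) (g := (atTop : Filter ℕ)))
    have a2 := hx1.comp (tendsto_snd (f := (atTop : Filter ℕ)) (g := (atTop : Filter ℕ)))
    have b1 := ht1.comp (tendsto_fst (f := (atTop : Filter ℕ)) (g := (atTop : Filter ℕ)))
    have b2 := ht1.comp (tendsto_snd (f := (atTop : Filter ℕ)) (g := (atTop : Filter ℕ)))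
    exact (((a1.dist a2).pow 2).add ((b1.sub b2).pow 2)).div (b1.mul b2) (by positivity)
  rw [dist_self, sub_self, prod_atTop_atTop_eq] at hT
  have hev := hT.eventually_lt_const (show (0 ^ 2 + 0 ^ 2) / (t * t) < ρ by simpa using hρ)
  obtain ⟨⟨N, N'⟩, hN⟩ := eventually_atTop.1 hev
  refine ⟨fun n => φ (max N N' + n), fun a b hab => hφ (by omega), fun n => ?_⟩
  exact hN (max N N' + 0, max N N' + n) ⟨by simp, by simp; omega⟩

/-- A boundary point of a tile lies in another tile. -/
theorem IsTil.exists_adjacent {𝒯 : Set (Set (HSpace d))} (hd : 1 ≤ d) (h : IsTil 𝒯)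
    {p : HSpace d} (hp : ∀ ρ > 0, ∃ q ∉ prototile d, qd p q < ρ) :
    ∃ T ∈ 𝒯, T ≠ prototile d ∧ p ∈ T := by
  -- Points outside the prototile tend to `p`, and each lies in some tile. If infinitely many of
  -- them lie in one tile, that tile contains `p` because it is closed.
  choose q hqB hq using fun n : ℕ => hp (1 / ((n : ℝ) + 1)) (by positivity)
  choose T hT hqT using fun n => h.cover (q n)
  choose g hg using fun n => h.copy _ (hT n)
  let c₀ : HSpace d := ⟨0, 3 / 2, by norm_num⟩
  have hb : ∀ b ∈ prototile d, qd b c₀ ≤ d + 1 := by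
    intro b hb
    have hbp := b.pos
    rw [qd, div_le_iff₀ (by positivity), dist_sq_eq]
    have h1 : ∑ i, (b.x i - c₀.x i) ^ 2 ≤ ∑ i : Fin d, (1 : ℝ) := by
      refine Finset.sum_le_sum fun i _ => ?_
      have := hb.1 i
      simpa [c₀, sq_le_one_iff_abs_le_one] using this
    simp only [Finset.sum_const, Finset.card_univ, Fintype.card_fin, nsmul_eq_mul, mul_one] at h1
    have h2 := hb.2.1
    have h3 := hb.2.2
    have h4 : (0 : ℝ) ≤ d := Nat.cast_nonneg d
    simp only [c₀] at h1 ⊢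
    nlinarith
  have hc : ∀ n, qd (q n) (g n c₀) ≤ d + 1 := by
    intro n
    have := hqT n
    rw [hg n, (g n).mem_image] at this
    have e := (g n).qd_map ((g n).symm (q n)) c₀
    rw [(g n).apply_symm] at e
    rw [e]
    exact hb _ this
  have hq1 : ∀ n, qd p (q n) ≤ 1 := fun n => (hq n).le.trans (by
    rw [div_le_one (by positivity)]; linarith [(Nat.cast_nonneg n : (0 : ℝ) ≤ n)])
  -- The centres stay in a bounded region; the explicit constant is a crude triangle inequality for
  -- `qd`, which is not a metric.
  have hM : ∃ M, ∀ n, qd p (g n c₀) ≤ M := by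
    refine ⟨(2 * (1 * (3 * p.t * p.t) + ((d : ℝ) + 1) * (3 * p.t * (((d : ℝ) + 3) * (3 * p.t)))) +
      (p.t + ((d : ℝ) + 3) * (3 * p.t)) ^ 2) / (p.t * (p.t / 3 / ((d : ℝ) + 3))), fun n => ?_⟩
    obtain ⟨a1, a2, a3, -⟩ := bounds_of_qd_le (hq1 n)
    obtain ⟨b1, b2, b3, -⟩ := bounds_of_qd_le (hc n)
    have hpp := p.pos
    have hqp := (q n).pos
    have hcp := (g n c₀).pos
    have e1 : (q n).t ≤ 3 * p.t := by linarith
    have hdp : (0 : ℝ) < d + 3 := by positivity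
    have e2 : (g n c₀).t ≤ ((d : ℝ) + 3) * (3 * p.t) := by
      refine b1.trans ?_
      rw [show (d : ℝ) + 1 + 2 = d + 3 by ring]
      gcongr
    have e3 : p.t / 3 / ((d : ℝ) + 3) ≤ (g n c₀).t := by
      rw [div_le_iff₀ hdp]
      linarith
    have e4 : dist p.x (g n c₀).x ^ 2 ≤
        2 * (dist p.x (q n).x ^ 2 + dist (q n).x (g n c₀).x ^ 2) := by
      have := pow_le_pow_left₀ dist_nonneg (dist_triangle p.x (q n).x (g n c₀).x) 2
      nlinarith [sq_nonneg (dist p.x (q n).x - dist (q n).x (g n c₀).x)]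
    have e5 : (p.t - (g n c₀).t) ^ 2 ≤ (p.t + ((d : ℝ) + 3) * (3 * p.t)) ^ 2 := by
      apply sq_le_sq'
      · linarith
      · have : 0 < ((d : ℝ) + 3) * (3 * p.t) := by positivity
        linarith
    have e6 : dist p.x (q n).x ^ 2 ≤ 1 * (3 * p.t * p.t) := by
      refine a3.trans ?_
      nlinarith
    have e7 : dist (q n).x (g n c₀).x ^ 2 ≤
        ((d : ℝ) + 1) * (3 * p.t * (((d : ℝ) + 3) * (3 * p.t))) := by
      refine b3.trans ?_
      gcongr
    rw [qd]
    gcongr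
    linarith
  obtain ⟨M, hM⟩ := hM
  obtain ⟨φ, hφ, hlt⟩ := exists_subseq_qd_lt hM (show (0 : ℝ) < 1 / 100 by norm_num)
  have hTT : ∀ n, T (φ 0) = T (φ n) := by
    intro n
    have hmem : (g (φ n)).symm (g (φ 0) c₀) ∈ openPrototile d := by
      apply mem_openPrototile_of_qd_lt
      have := (g (φ n)).qd_map c₀ ((g (φ n)).symm (g (φ 0) c₀))
      rw [HIsom.apply_symm, qd_comm] at this
      rw [← this]
      exact hlt n
    have hT1 : g (φ n) '' prototile d ∈ 𝒯 := hg (φ n) ▸ hT (φ n)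
    have := h.eq_of_mem_open hd hT1 (hT (φ 0)) hmem (by
      rw [HIsom.apply_symm, hg (φ 0)]
      refine Set.mem_image_of_mem _ ⟨fun i => by simp [c₀], ?_, ?_⟩ <;> norm_num [c₀])
    rw [← this, ← hg]
  refine ⟨T (φ 0), hT _, fun e => hqB (φ 0) (e ▸ hqT _), ?_⟩
  rw [hg (φ 0), HIsom.mem_image]
  refine mem_prototile_of_approx fun ρ hρ => ?_
  obtain ⟨N, hN⟩ := exists_nat_one_div_lt hρ
  refine ⟨(g (φ 0)).symm (q (φ N)), ?_, ?_⟩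
  · rw [← HIsom.mem_image, ← hg, hTT N]
    exact hqT _
  · rw [HIsom.qd_map]
    refine (hq _).trans (lt_of_le_of_lt ?_ hN)
    have : N ≤ φ N := hφ.id_le N
    gcongr

/-! ### The neighbours of a tile -/

/-- A point in the relative interior of a facet. -/
noncomputable def FacetName.point : FacetName d → HSpace d
  | .a => pt2 0
  | .b σ => pt1 ((1 / 2 : ℝ) • signVec σ)
  | .c i ε => ⟨EuclideanSpace.single i ((ε : ℤ) : ℝ), 3 / 2, by norm_num⟩

theorem abs_half_units_le (ε : ℤˣ) : |2⁻¹ * ((ε : ℤ) : ℝ)| ≤ 1 := by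
  rw [abs_mul, abs_units]; norm_num

theorem abs_single_le (i j : Fin d) (ε : ℤˣ) :
    |(EuclideanSpace.single i ((ε : ℤ) : ℝ)) j| ≤ 1 := by
  by_cases h : j = i <;> simp [h, abs_units]

theorem FacetName.point_mem (f : FacetName d) : f.point ∈ facet f := by
  cases f with
  | a => simp [FacetName.point, facet, prototile]
  | b σ =>
    refine ⟨⟨fun i => ?_, le_rfl, one_le_two⟩, rfl, fun i => ?_⟩
    · simpa [FacetName.point] using abs_half_units_le (σ i)
    · simp [FacetName.point, mul_assoc, sq_units]
  | c i ε =>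
    refine ⟨⟨fun j => abs_single_le i j ε, ?_, ?_⟩, ?_⟩ <;> norm_num [FacetName.point]

theorem FacetName.eq_of_point_mem {f f' : FacetName d} (h : f.point ∈ facet f') : f' = f := by
  cases f with
  | a =>
    cases f' with
    | a => rfl
    | b τ => exact absurd h.2.1 (by norm_num [FacetName.point])
    | c j δ =>
      have := h.2
      simp only [FacetName.point, PiLp.zero_apply] at this
      have h1 := abs_units δ
      rw [← this] at h1
      norm_num at h1
  | b σ =>
    cases f' with
    | a => exact absurd h.2 (by norm_num [FacetName.point])
    | b τ =>
      congr 1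
      funext i
      have := h.2.2 i
      rcases Int.units_eq_one_or (τ i) with e | e <;>
        rcases Int.units_eq_one_or (σ i) with e' | e' <;>
        simp [FacetName.point, e, e'] at this ⊢ <;> norm_num at this
    | c j δ =>
      have := congrArg abs h.2
      simp only [FacetName.point, PiLp.smul_apply, smul_eq_mul, signVec_apply, abs_mul,
        abs_units] at this
      norm_num at this
  | c i ε =>
    cases f' with
    | a => exact absurd h.2 (by norm_num [FacetName.point])
    | b τ => exact absurd h.2.1 (by norm_num [FacetName.point])
    | c j δ =>
      have := h.2
      simp only [FacetName.point] at this
      by_cases hj : j = i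
      · subst hj
        simp only [PiLp.single_apply, if_true] at this
        rw [show δ = ε from Units.ext (Int.cast_injective (α := ℝ) this.symm)]
      · have h1 := abs_units δ
        rw [← this] at h1
        simp [hj] at h1

theorem FacetName.exists_near_point (f : FacetName d) {ρ : ℝ} (hρ : 0 < ρ) :
    ∃ q ∉ prototile d, qd f.point q < ρ := by
  obtain ⟨η, h0, h1, h2⟩ : ∃ η > 0, η < ρ ∧ η ≤ 1 / 2 :=
    ⟨min (ρ / 2) (1 / 2), by positivity, (min_le_left _ _).trans_lt (by linarith), min_le_right _ _⟩
  cases f with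
  | a =>
    refine ⟨⟨0, 2 + η, by positivity⟩, fun h => ?_, ?_⟩
    · have : 2 + η ≤ 2 := h.2.2
      linarith
    · simp only [qd, FacetName.point, dist_self]
      rw [div_lt_iff₀ (by positivity)]
      nlinarith
  | b σ =>
    refine ⟨⟨(1 / 2 : ℝ) • signVec σ, 1 - η, by linarith⟩, fun h => ?_, ?_⟩
    · have : 1 ≤ 1 - η := h.2.1
      linarith
    · simp only [qd, FacetName.point, dist_self]
      rw [div_lt_iff₀ (by linarith)]
      nlinarith
  | c i ε =>
    refine ⟨⟨EuclideanSpace.single i ((1 + η) * ((ε : ℤ) : ℝ)), 3 / 2, by norm_num⟩,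
      fun h => ?_, ?_⟩
    · have := h.1 i
      simp only [PiLp.single_apply, if_true, abs_mul, abs_units, mul_one] at this
      rw [abs_of_pos (by linarith)] at this
      linarith
    · simp only [qd, FacetName.point]
      have : dist (EuclideanSpace.single i ((ε : ℤ) : ℝ) : EuclideanSpace ℝ (Fin d))
          (EuclideanSpace.single i ((1 + η) * ((ε : ℤ) : ℝ))) = η := by
        rw [PiLp.dist_single_same, Real.dist_eq,
          show ((ε : ℤ) : ℝ) - (1 + η) * ((ε : ℤ) : ℝ) = -(η * ((ε : ℤ) : ℝ)) by ring, abs_neg,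
          abs_mul, abs_units, abs_of_pos h0, mul_one]
      rw [this, div_lt_iff₀ (by norm_num)]
      nlinarith

/-- Across each facet of the prototile there is another tile. -/
theorem IsTil.exists_across {𝒯 : Set (Set (HSpace d))} (hd : 1 ≤ d) (h : IsTil 𝒯)
    (hB : prototile d ∈ 𝒯) (f : FacetName d) :
    ∃ g : HIsom d, g '' prototile d ∈ 𝒯 ∧ g '' prototile d ≠ prototile d ∧
      prototile d ∩ g '' prototile d = facet f ∧
      ∃ S : Set (FacetName d), S.Nonempty ∧ g.symm '' facet f = ⋂ f ∈ S, facet f := by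
  obtain ⟨T, hT, hne, hp⟩ := h.exists_adjacent hd fun ρ hρ => f.exists_near_point hρ
  obtain ⟨g, rfl⟩ := h.copy T hT
  have hpB : f.point ∈ prototile d := by
    have := f.point_mem
    cases f <;> exact this.1
  obtain ⟨f1, f2⟩ := h.face_to_face _ hB _ hT hne.symm ⟨_, hpB, hp⟩
  have hinter : prototile d ∩ g '' prototile d = facet f := by
    have hid : shiftIsom 0 0 '' prototile d = prototile d := shift_zero_image _
    rw [← hid] at f1
    obtain ⟨S, ⟨f₀, hf₀⟩, hS⟩ := f1.exists_facets hd
    rw [hid, shiftIsom_image, shift_zero_image] at hS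
    have hpS : f.point ∈ ⋂ f ∈ S, facet f := hS ▸ ⟨hpB, hp⟩
    -- The chosen point lies in no facet other than `f`, so the common face is all of `f`.
    have hall : ∀ f' ∈ S, f' = f := fun f' hf' =>
      FacetName.eq_of_point_mem (Set.mem_iInter₂.1 hpS f' hf')
    rw [hS]
    exact biInter_eq_of_forall_eq (hall _ hf₀ ▸ hf₀) hall
  refine ⟨g, hT, hne, hinter, ?_⟩
  rw [hinter] at f2
  obtain ⟨S, hS, e⟩ := f2.exists_facets hd
  exact ⟨S, hS, by rw [e, g.symm_image_image]⟩

theorem shift_image_facet_b (σ : Fin d → ℤˣ) :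
    shiftIsom 1 (-signVec σ) '' facet (.b σ) = facet .a := by
  refine image_eq_of_mem_iff _ fun p => ?_
  simp only [facet, prototile, Set.mem_ofPred_eq, shiftIsom_apply, shift, zpow_one,
    PiLp.add_apply, PiLp.smul_apply, PiLp.neg_apply, smul_eq_mul, signVec_apply]
  constructor
  · rintro ⟨⟨h1, -, -⟩, h2, h3⟩
    refine ⟨⟨fun i => ?_, ?_, ?_⟩, ?_⟩ <;> try (rw [h2]; norm_num)
    have a1 := abs_le.1 (h1 i)
    have a2 := h3 i
    rw [abs_le]
    rcases Int.units_eq_one_or (σ i) with e | e <;> simp [e] at a2 ⊢ <;>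
      constructor <;> linarith
  · rintro ⟨⟨h1, -, -⟩, h2⟩
    have h2' : p.t = 1 := by linarith
    refine ⟨⟨fun i => ?_, by linarith, by linarith⟩, h2', fun i => ?_⟩ <;>
    · have a1 := abs_le.1 (h1 i)
      rcases Int.units_eq_one_or (σ i) with e | e <;> simp [e, abs_le] at a1 ⊢ <;>
        first | linarith | (constructor <;> linarith)

/-- The neighbour above meets the prototile in its own `a`- or `b`-facet. In the first case rigidity
would make it the prototile itself; in the second it is the standard parent up to a symmetry. -/
theorem IsTil.exists_parent {𝒯 : Set (Set (HSpace d))} (hd : 1 ≤ d) (h : IsTil 𝒯)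
    (hB : prototile d ∈ 𝒯) : ∃ σ, shift 1 (-signVec σ) '' prototile d ∈ 𝒯 := by
  obtain ⟨g, hT, hne, -, S, hS, e⟩ := h.exists_across hd hB .a
  obtain ⟨f', hf', e'⟩ := exists_horo_facet g.symm (Or.inl rfl) e
  rcases hf' with rfl | ⟨σ, rfl⟩
  · have := image_prototile_of_image_facet_a hd _ e'
    rw [g.symm.image_eq_iff] at this
    exact absurd this.symm hne
  · set s := shiftIsom 1 (-signVec σ) with hs
    have hsb : s '' facet (.b σ) = facet .a := shift_image_facet_b σ
    obtain ⟨k, hgk⟩ : ∃ k : HIsom d, ∀ p, g p = k (s p) := ⟨g.comp s.symm, fun p => by simp⟩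
    have hgk' : ∀ U, g '' U = k '' (s '' U) := fun U => by
      rw [Set.image_image]; exact Set.image_congr fun p _ => hgk p
    have ha : k '' facet .a = facet .a := by
      rw [← hsb, ← hgk', ← e', g.image_symm_image, e', hsb]
    have hk := image_prototile_of_image_facet_a hd _ ha
    have ht := t_eq_of_image_facet_a hd _ ha
    obtain ⟨π, ε, hπ⟩ := exists_signed_perm hd _ hk
    refine ⟨fun i => ε i * σ (π i), ?_⟩
    convert hT using 1
    -- The symmetry `k` is a signed permutation, so moving it past the shift only permutes and
    -- changes the signs in `σ`.
    have hcomm : ∀ p, g p = shift 1 (-signVec fun i => ε i * σ (π i)) (k p) := by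
      intro p
      rw [hgk]
      ext i
      · rw [hπ]
        simp only [shift, hs, shiftIsom_apply, PiLp.add_apply, PiLp.smul_apply, PiLp.neg_apply,
          smul_eq_mul, signVec_apply, hπ]
        push_cast
        ring
      · rw [ht]
        simp only [shift, hs, shiftIsom_apply, ht]
    conv_lhs => rw [← hk, Set.image_image]
    exact Set.image_congr fun p _ => (hcomm p).symm

/-- If the neighbour below met the prototile in one of its `b`-facets, rigidity would place both
tiles on the same side of the horosphere, and they would overlap. -/
theorem IsTil.child_mem {𝒯 : Set (Set (HSpace d))} (hd : 1 ≤ d) (h : IsTil 𝒯)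
    (hB : prototile d ∈ 𝒯) (σ : Fin d → ℤˣ) :
    shift (-1) ((1 / 2 : ℝ) • signVec σ) '' prototile d ∈ 𝒯 := by
  obtain ⟨g, hT, hne, hint, S, hS, e⟩ := h.exists_across hd hB (.b σ)
  obtain ⟨f', hf', e'⟩ := exists_horo_facet g.symm (Or.inr ⟨σ, rfl⟩) e
  set s := shiftIsom 1 (-signVec σ) with hs
  have hsymm : ∀ p, s.symm p = shift (-1) ((1 / 2 : ℝ) • signVec σ) p := by
    intro p
    apply s.injective
    rw [s.apply_symm, hs, shiftIsom_apply, shift_shift]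
    norm_num [smul_smul, shift_zero]
  rcases hf' with rfl | ⟨τ, rfl⟩
  · have ha : s.comp g '' facet .a = facet .a := by
      rw [s.comp_image, ← e', g.image_symm_image, e', shift_image_facet_b]
    have hk := image_prototile_of_image_facet_a hd _ ha
    rw [s.comp_image, s.image_eq_iff] at hk
    rw [hk] at hT
    rwa [Set.image_congr fun p _ => hsymm p] at hT
  · exfalso
    set r := shiftIsom 1 (-signVec τ) with hr
    have ha : (s.comp g).comp r.symm '' facet .a = facet .a := by
      have hra : r.symm '' facet .a = facet (.b τ) := by
        rw [← shift_image_facet_b τ, ← hr, r.symm_image_image]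
      rw [HIsom.comp_image, hra, ← e', s.comp_image, g.image_symm_image, shift_image_facet_b]
    have hk := image_prototile_of_image_facet_a hd _ ha
    obtain ⟨A, hA, -⟩ := linear_of_symmetry hd _ hk
    -- The point above the centre of `b τ` is sent to the one above the centre of `b σ`, so both
    -- tiles contain a point of height `3/2`, off the common facet.
    let q : HSpace d := ⟨(1 / 2 : ℝ) • signVec τ, 3 / 2, by norm_num⟩
    have hmem : ∀ υ : Fin d → ℤˣ,
        (⟨(1 / 2 : ℝ) • signVec υ, 3 / 2, by norm_num⟩ : HSpace d) ∈ prototile d := by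
      intro υ
      refine ⟨fun i => ?_, by norm_num, by norm_num⟩
      simpa using abs_half_units_le (υ i)
    have e1 : s (g q) = ⟨0, 3, by norm_num⟩ := by
      have := hA (r q)
      simp only [HIsom.comp_apply, HIsom.symm_apply] at this
      rw [this]
      ext1
      · simp [hr, q, shift, smul_smul]
      · simp [hr, q, shift]
        norm_num
    have e2 : g q = ⟨(1 / 2 : ℝ) • signVec σ, 3 / 2, by norm_num⟩ := by
      rw [← s.symm_apply (g q), e1, hsymm]
      ext1
      · simp [shift]
      · simp [shift]
        norm_num
    have hm : g q ∈ prototile d ∩ g '' prototile d :=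
      ⟨e2 ▸ hmem σ, Set.mem_image_of_mem _ (hmem τ)⟩
    rw [hint] at hm
    have := hm.2.1
    rw [e2] at this
    norm_num at this

/-- The isometry between the `c`-facets of adjacent tiles preserves the vertical axes. -/
theorem axis_map_of_c_facet {𝒯 : Set (Set (HSpace d))} (hd : 1 ≤ d) (h : IsTil 𝒯)
    (hB : prototile d ∈ 𝒯) {g : HIsom d} (hT : g '' prototile d ∈ 𝒯) {i j : Fin d} {ε δ : ℤˣ}
    (hc : g '' facet (.c j δ) = facet (.c i ε)) :
    g (pt1 (EuclideanSpace.single j ((δ : ℤ) : ℝ))) =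
        pt1 (EuclideanSpace.single i ((ε : ℤ) : ℝ)) ∧
      g (pt2 (EuclideanSpace.single j ((δ : ℤ) : ℝ))) =
        pt2 (EuclideanSpace.single i ((ε : ℤ) : ℝ)) := by
  -- For `d = 1` a `c`-edge is a bare segment that an isometry may reverse; orientation forbids
  -- this. For `d ≥ 2` the facet is a box in `d - 1 ≥ 1` directions and has a rigid axis.
  rcases hd.eq_or_lt with h1 | h1
  · have hid : shiftIsom 0 0 '' prototile d = prototile d := shift_zero_image _
    have hid' : ∀ f, facet f = shiftIsom (0 : ℤ) (0 : EuclideanSpace ℝ (Fin d)) '' facet f :=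
      fun f => (shift_zero_image _).symm
    have ho := h.oriented h1.symm _ hB _ hT (facet (.c i ε)) (facet .a) (g '' facet .a)
      ⟨_, hid.symm, i, ε, hid' _⟩ ⟨g, rfl, j, δ, hc.symm⟩ ⟨_, hid.symm, hid' _⟩ ⟨g, rfl, rfl⟩
    have hm : ∀ p : HSpace d, p.x = EuclideanSpace.single j ((δ : ℤ) : ℝ) → 1 ≤ p.t → p.t ≤ 2 →
        g p ∈ facet (.c i ε) := by
      intro p hp a1 a2
      rw [← hc]
      refine Set.mem_image_of_mem _ ?_
      rw [facet_c_eq_box, ← hp]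
      exact axis_mem_box a1 a2
    have hx : ∀ p ∈ facet (.c i ε), p.x = EuclideanSpace.single i ((ε : ℤ) : ℝ) := by
      intro p hp
      subst h1
      ext k
      rw [Subsingleton.elim k i]
      simpa using hp.2
    have m1 := hm (pt1 (EuclideanSpace.single j ((δ : ℤ) : ℝ))) rfl le_rfl one_le_two
    have m2 := hm (pt2 (EuclideanSpace.single j ((δ : ℤ) : ℝ))) rfl one_le_two le_rfl
    have e2 : g (pt2 (EuclideanSpace.single j ((δ : ℤ) : ℝ))) =
        pt2 (EuclideanSpace.single i ((ε : ℤ) : ℝ)) := by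
      refine HSpace.ext (hx _ m2) ?_
      have : g (pt2 (EuclideanSpace.single j ((δ : ℤ) : ℝ))) ∈
          facet (.c i ε) ∩ facet .a := by
        rw [ho]
        refine ⟨m2, Set.mem_image_of_mem _ ⟨⟨fun k => abs_single_le j k δ, one_le_two, le_rfl⟩, rfl⟩⟩
      exact this.2.2
    refine ⟨HSpace.ext (hx _ m1) ?_, e2⟩
    have e := g.qd_map (pt1 (EuclideanSpace.single j ((δ : ℤ) : ℝ)))
      (pt2 (EuclideanSpace.single j ((δ : ℤ) : ℝ)))
    rw [e2, qd, qd, hx _ m1] at e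
    have hp := (g (pt1 (EuclideanSpace.single j ((δ : ℤ) : ℝ)))).pos
    have hle := m1.1.2.2
    simp only [dist_self] at e ⊢
    field_simp at e
    nlinarith
  · rw [facet_c_eq_box, facet_c_eq_box] at hc
    exact axis_map_eq (by simp; omega) (by simp) g hc

/-- Recentred at the two axes, `g` is a linear isometry taking the `j`-th axis to the `i`-th and
cube to cube in the other directions. Only the side of the facet remains free: `η = ε` gives the
prototile and `η = -ε` its translate. -/
theorem mem_prototile_iff_of_c_facet {g : HIsom d} {i j : Fin d} {ε δ : ℤˣ}
    (hc : g '' facet (.c j δ) = facet (.c i ε))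
    (h1 : g (pt1 (EuclideanSpace.single j ((δ : ℤ) : ℝ))) =
        pt1 (EuclideanSpace.single i ((ε : ℤ) : ℝ)))
    (h2 : g (pt2 (EuclideanSpace.single j ((δ : ℤ) : ℝ))) =
        pt2 (EuclideanSpace.single i ((ε : ℤ) : ℝ))) :
    ∃ η : ℤˣ, ∀ p, p ∈ prototile d ↔ (∀ l, l ≠ i → |(g p).x l| ≤ 1) ∧
      |(g p).x i - ((ε : ℤ) : ℝ) + ((η : ℤ) : ℝ)| ≤ 1 ∧ 1 ≤ (g p).t ∧ (g p).t ≤ 2 := by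
  have ht := t_eq_of_vertical g h1 h2
  set w := EuclideanSpace.single i ((ε : ℤ) : ℝ) with hw
  set w' := EuclideanSpace.single j ((δ : ℤ) : ℝ) with hw'
  have hz : ∀ (v : EuclideanSpace ℝ (Fin d)) (p : HSpace d),
      shift 0 v p = ⟨p.x + v, p.t, p.pos⟩ := by
    intro v p
    ext1 <;> simp [shift]
  obtain ⟨A, hA'⟩ := exists_linear ((shiftIsom 0 (-w)).comp (g.comp (shiftIsom 0 w')))
    (fun p => by simp [hz, ht]) (w := 0) (by simp [hz, h1])
  have hA : ∀ p, g p = ⟨A (p.x - w') + w, p.t, p.pos⟩ := by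
    intro p
    have := hA' ⟨p.x - w', p.t, p.pos⟩
    simp only [HIsom.comp_apply, shiftIsom_apply, hz, sub_add_cancel] at this
    have e := congrArg HSpace.x this
    simp only [add_zero] at e
    refine HSpace.ext ?_ (ht p)
    simp only
    rw [← e]
    abel
  have hF : ∀ u : EuclideanSpace ℝ (Fin d),
      ((∀ l, l ≠ j → |u l| ≤ 1) ∧ u j = 0) ↔ (∀ l, l ≠ i → |A u l| ≤ 1) ∧ A u i = 0 := by
    intro u
    rw [facet_c_eq_box, facet_c_eq_box] at hc
    have := mem_iff_of_image_eq g hc (pt1 (u + w'))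
    rw [hA] at this
    simpa [box, ← hw, ← hw'] using this
  have hAi : ∀ l, l ≠ i → A (EuclideanSpace.single j 1) l = 0 := by
    intro l hl
    have : (A.symm (EuclideanSpace.single l 1)) j = 0 := by
      refine ((hF (A.symm (EuclideanSpace.single l 1))).2 ?_).2
      rw [A.apply_symm_apply]
      refine ⟨fun m _ => ?_, by simp [hl.symm]⟩
      by_cases hm : m = l <;> simp [hm]
    rw [← inner_single_right, ← A.symm.inner_map_map, A.symm_apply_apply, real_inner_comm,
      inner_single_right, this]
  set c := A (EuclideanSpace.single j 1) i with hcdef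
  have hAj : A (EuclideanSpace.single j 1) = EuclideanSpace.single i c := by
    ext l
    by_cases hl : l = i
    · subst hl; simp [hcdef]
    · simp [hl, hAi l hl]
  have hc1 : |c| = 1 := by
    have := A.norm_map (EuclideanSpace.single j 1)
    rw [hAj] at this
    simpa using this
  have hAz : ∀ z, A z i = c * z j := by
    intro z
    have : inner ℝ (A z) (A (EuclideanSpace.single j 1)) = z j := by
      rw [A.inner_map_map, inner_single_right]
    rw [hAj, EuclideanSpace.inner_single_right] at this
    simp only [conj_trivial] at this
    have hcc : c * c = 1 := by rw [← abs_mul_abs_self, hc1, one_mul]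
    rw [← this, ← mul_assoc, hcc, one_mul]
  have key : ∀ z : EuclideanSpace ℝ (Fin d),
      (∀ l, l ≠ j → |z l| ≤ 1) ↔ ∀ l, l ≠ i → |A z l| ≤ 1 := by
    intro z
    have := hF (z - EuclideanSpace.single j (z j))
    have hs : A (EuclideanSpace.single j (z j)) = EuclideanSpace.single i (c * z j) := by
      have : EuclideanSpace.single j (z j) = z j • EuclideanSpace.single j (1 : ℝ) := by
        ext l; by_cases hl : l = j <;> simp [hl]
      rw [this, map_smul, hAj]
      ext l
      by_cases hl : l = i <;> simp [hl, mul_comm]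
    rw [map_sub, hs] at this
    have e1 : ∀ l, l ≠ j → (z - EuclideanSpace.single j (z j)) l = z l := fun l hl => by simp [hl]
    have e2 : ∀ l, l ≠ i → (A z - EuclideanSpace.single i (c * z j)) l = A z l :=
      fun l hl => by simp [hl]
    have e3 : (z - EuclideanSpace.single j (z j)) j = 0 := by simp
    have e4 : (A z - EuclideanSpace.single i (c * z j)) i = 0 := by simp [hAz]
    simp only [e3, e4, and_true] at this
    constructor
    · intro H l hl
      rw [← e2 l hl]
      exact this.1 (fun m hm => by rw [e1 m hm]; exact H m hm) l hl
    · intro H l hl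
      rw [← e1 l hl]
      exact this.2 (fun m hm => by rw [e2 m hm]; exact H m hm) l hl
  obtain ⟨η, hη⟩ : ∃ η : ℤˣ, ((η : ℤ) : ℝ) = c * ((δ : ℤ) : ℝ) := by
    rcases (abs_eq one_pos.le).1 hc1 with e | e
    · exact ⟨δ, by rw [e, one_mul]⟩
    · exact ⟨-δ, by rw [e]; simp⟩
  refine ⟨η, fun p => ?_⟩
  have k := key (p.x - w')
  have f1 : ∀ l, l ≠ j → (p.x - w') l = p.x l := fun l hl => by simp [hw', hl]
  have f2 : ∀ l, l ≠ i → (g p).x l = A (p.x - w') l := fun l hl => by rw [hA]; simp [hw, hl]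
  have f3 : (g p).x i - ((ε : ℤ) : ℝ) + ((η : ℤ) : ℝ) = c * p.x j := by
    rw [hA, hη]
    simp only [PiLp.add_apply, hAz, PiLp.sub_apply]
    simp only [hw, hw', PiLp.single_apply, if_true]
    ring
  rw [ht, f3, abs_mul, hc1, one_mul]
  constructor
  · rintro ⟨a1, a2⟩
    refine ⟨fun l hl => ?_, a1 j, a2⟩
    rw [f2 l hl]
    exact k.1 (fun m hm => by rw [f1 m hm]; exact a1 m) l hl
  · rintro ⟨a1, a2, a3⟩
    refine ⟨fun l => ?_, a3⟩
    by_cases hl : l = j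
    · rw [hl]; exact a2
    · rw [← f1 l hl]
      exact k.2 (fun m hm => by rw [← f2 m hm]; exact a1 m hm) l hl

theorem IsTil.sibling_mem {𝒯 : Set (Set (HSpace d))} (hd : 1 ≤ d) (h : IsTil 𝒯)
    (hB : prototile d ∈ 𝒯) (i : Fin d) (ε : ℤˣ) :
    shift 0 (EuclideanSpace.single i (2 * ((ε : ℤ) : ℝ))) '' prototile d ∈ 𝒯 := by
  obtain ⟨g, hT, hne, -, S, hS, e⟩ := h.exists_across hd hB (.c i ε)
  obtain ⟨j, δ, hj⟩ := exists_c_facet g.symm hS e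
  have hc : g '' facet (.c j δ) = facet (.c i ε) := by rw [← hj, g.image_symm_image]
  obtain ⟨h1, h2⟩ := axis_map_of_c_facet hd h hB hT hc
  obtain ⟨η, hη⟩ := mem_prototile_iff_of_c_facet hc h1 h2
  have hcase : η = ε ∨ η = -ε := by
    rcases Int.units_eq_one_or η with rfl | rfl <;> rcases Int.units_eq_one_or ε with rfl | rfl <;>
      simp
  rcases hcase with rfl | rfl
  · refine absurd (image_eq_of_mem_iff g fun p => ?_) hne
    rw [hη, sub_add_cancel]
    constructor
    · rintro ⟨a1, a2, a3⟩
      refine ⟨fun l => ?_, a3⟩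
      by_cases hl : l = i
      · rw [hl]; exact a2
      · exact a1 l hl
    · rintro ⟨a1, a2⟩
      exact ⟨fun l _ => a1 l, a1 i, a2⟩
  · convert hT using 1
    rw [← shiftIsom_image, eq_comm]
    refine image_eq_of_mem_iff g fun p => ?_
    rw [hη, HIsom.mem_image]
    have hs : (shiftIsom 0 (EuclideanSpace.single i (2 * ((ε : ℤ) : ℝ)))).symm (g p) =
        ⟨(g p).x - EuclideanSpace.single i (2 * ((ε : ℤ) : ℝ)), (g p).t, (g p).pos⟩ := by
      apply (shiftIsom 0 (EuclideanSpace.single i (2 * ((ε : ℤ) : ℝ)))).injective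
      rw [HIsom.apply_symm]
      ext1 <;> simp [shift]
    rw [hs]
    have f1 : ∀ l, l ≠ i → ((g p).x - EuclideanSpace.single i (2 * ((ε : ℤ) : ℝ))) l = (g p).x l :=
      fun l hl => by simp [hl]
    have f2 : ((g p).x - EuclideanSpace.single i (2 * ((ε : ℤ) : ℝ))) i =
        (g p).x i - ((ε : ℤ) : ℝ) + (((-ε : ℤˣ) : ℤ) : ℝ) := by
      simp
      ring
    rw [← f2]
    constructor
    · rintro ⟨a1, a2, a3⟩
      refine ⟨fun l => ?_, a3⟩
      by_cases hl : l = i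
      · rw [hl]; exact a2
      · simp only [f1 l hl]
        exact a1 l hl
    · rintro ⟨a1, a2⟩
      refine ⟨fun l hl => ?_, a1 i, a2⟩
      rw [← f1 l hl]
      exact a1 l

/-! ### The grid of tiles -/

theorem two_zpow_succ (k : ℤ) : (2 : ℝ) ^ (k + 1) = 2 ^ k * 2 := zpow_add_one₀ two_ne_zero k

theorem shiftIsom_symm_apply (k : ℤ) (v : EuclideanSpace ℝ (Fin d)) (p : HSpace d) :
    (shiftIsom k v).symm p = shift (-k) (-((2 : ℝ) ^ (-k) • v)) p := rfl

theorem shiftIsom_symm_x (k : ℤ) (v : EuclideanSpace ℝ (Fin d)) (p : HSpace d) (i : Fin d) :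
    ((shiftIsom k v).symm p).x i = (p.x i - v i) / 2 ^ k := by
  rw [shiftIsom_symm_apply]
  simp [shift]
  field_simp
  ring

theorem shiftIsom_symm_t (k : ℤ) (v : EuclideanSpace ℝ (Fin d)) (p : HSpace d) :
    ((shiftIsom k v).symm p).t = p.t / 2 ^ k := by
  rw [shiftIsom_symm_apply]
  simp [shift]
  field_simp

theorem mem_shift_prototile {k : ℤ} {v : EuclideanSpace ℝ (Fin d)} {p : HSpace d} :
    p ∈ shift k v '' prototile d ↔
      (∀ i, |p.x i - v i| ≤ 2 ^ k) ∧ 2 ^ k ≤ p.t ∧ p.t ≤ 2 ^ (k + 1) := by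
  have h2 : (0 : ℝ) < 2 ^ k := by positivity
  rw [← shiftIsom_image, HIsom.mem_image]
  simp only [prototile, Set.mem_ofPred_eq, shiftIsom_symm_x, shiftIsom_symm_t, abs_div,
    abs_of_pos h2, div_le_iff₀ h2, le_div_iff₀ h2, one_mul, two_zpow_succ, mul_comm]

theorem mem_shift_facet_a {k : ℤ} {v : EuclideanSpace ℝ (Fin d)} {p : HSpace d} :
    p ∈ shift k v '' facet .a ↔ (∀ i, |p.x i - v i| ≤ 2 ^ k) ∧ p.t = 2 ^ (k + 1) := by
  have h2 : (0 : ℝ) < 2 ^ k := by positivity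
  rw [← shiftIsom_image, HIsom.mem_image]
  simp only [facet, prototile, Set.mem_ofPred_eq, shiftIsom_symm_x, shiftIsom_symm_t, abs_div,
    abs_of_pos h2, div_le_iff₀ h2, one_mul, two_zpow_succ, le_div_iff₀ h2, div_eq_iff h2.ne']
  constructor
  · rintro ⟨⟨h1, -⟩, h3⟩
    exact ⟨h1, by linarith⟩
  · rintro ⟨h1, h3⟩
    exact ⟨⟨h1, by linarith, by linarith⟩, by linarith⟩

theorem apply_le_of_subset {k : ℤ} {v w : EuclideanSpace ℝ (Fin d)}
    (h : ∀ x : EuclideanSpace ℝ (Fin d), (∀ i, |x i - v i| ≤ 2 ^ k) → ∀ i, |x i - w i| ≤ 2 ^ k)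
    (i : Fin d) : v i ≤ w i := by
  have h2 : (0 : ℝ) < 2 ^ k := by positivity
  have := h (WithLp.toLp 2 fun i => v i + 2 ^ k) (fun i => by simp [abs_of_pos h2]) i
  have := (abs_le.1 this).2
  simp only at this
  linarith

theorem shift_prototile_injective {k l : ℤ} {v w : EuclideanSpace ℝ (Fin d)}
    (h : shift k v '' prototile d = shift l w '' prototile d) : k = l ∧ v = w := by
  have key : ∀ {k l : ℤ} {v w : EuclideanSpace ℝ (Fin d)},
      shift k v '' prototile d = shift l w '' prototile d → (2 : ℝ) ^ l ≤ 2 ^ k := by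
    intro k l v w h
    have : (⟨v, 2 ^ k, by positivity⟩ : HSpace d) ∈ shift l w '' prototile d := by
      rw [← h, mem_shift_prototile]
      refine ⟨fun i => by simp; positivity, le_rfl, ?_⟩
      exact zpow_le_zpow_right₀ one_le_two (by omega)
    exact (mem_shift_prototile.1 this).2.1
  have hkl : k = l := zpow_right_injective₀ two_pos (by norm_num : (2 : ℝ) ≠ 1)
    (le_antisymm (key h.symm) (key h))
  subst hkl
  refine ⟨rfl, ?_⟩
  have key2 : ∀ {v w : EuclideanSpace ℝ (Fin d)},
      shift k v '' prototile d = shift k w '' prototile d → ∀ i, v i ≤ w i := by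
    intro v w h
    refine apply_le_of_subset (k := k) fun x hx => ?_
    have : (⟨x, 2 ^ k, by positivity⟩ : HSpace d) ∈ shift k w '' prototile d := by
      rw [← h, mem_shift_prototile]
      exact ⟨hx, le_rfl, zpow_le_zpow_right₀ one_le_two (by omega)⟩
    exact (mem_shift_prototile.1 this).1
  ext i
  exact le_antisymm (key2 h i) (key2 h.symm i)

theorem shift_facet_a_injective {k l : ℤ} {v w : EuclideanSpace ℝ (Fin d)}
    (h : shift k v '' facet .a = shift l w '' facet .a) : k = l ∧ v = w := by
  have hmem : ∀ (k : ℤ) (v : EuclideanSpace ℝ (Fin d)),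
      (⟨v, 2 ^ (k + 1), by positivity⟩ : HSpace d) ∈ shift k v '' facet .a := by
    intro k v
    rw [mem_shift_facet_a]
    exact ⟨fun i => by simp; positivity, rfl⟩
  have hkl : k = l := by
    have := hmem k v
    rw [h, mem_shift_facet_a] at this
    have := zpow_right_injective₀ two_pos (by norm_num : (2 : ℝ) ≠ 1) this.2
    omega
  subst hkl
  refine ⟨rfl, ?_⟩
  have key2 : ∀ {v w : EuclideanSpace ℝ (Fin d)},
      shift k v '' facet .a = shift k w '' facet .a → ∀ i, v i ≤ w i := by
    intro v w h
    refine apply_le_of_subset (k := k) fun x hx => ?_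
    have : (⟨x, 2 ^ (k + 1), by positivity⟩ : HSpace d) ∈ shift k w '' facet .a := by
      rw [← h, mem_shift_facet_a]
      exact ⟨hx, rfl⟩
    exact (mem_shift_facet_a.1 this).1
  ext i
  exact le_antisymm (key2 h i) (key2 h.symm i)

theorem shift_facet_b (l : ℤ) (w : EuclideanSpace ℝ (Fin d)) (σ : Fin d → ℤˣ) :
    shift l w '' facet (.b σ) =
      shift (l - 1) (w + (2 : ℝ) ^ (l - 1) • signVec σ) '' facet .a := by
  rw [← shift_image_facet_b σ, shiftIsom_image, shift_image_shift]
  congr 2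
  · ring
  · module

/-- The vector with integer coordinates `z`. -/
noncomputable def intVec (z : Fin d → ℤ) : EuclideanSpace ℝ (Fin d) :=
  WithLp.toLp 2 fun i => ((z i : ℤ) : ℝ)

@[simp] theorem intVec_apply (z : Fin d → ℤ) (i : Fin d) : intVec z i = ((z i : ℤ) : ℝ) := rfl

section Grid

variable {𝒯 : Set (Set (HSpace d))}

theorem IsTil.parent_grid (hd : 1 ≤ d) (h : IsTil 𝒯) {k : ℤ} {v : EuclideanSpace ℝ (Fin d)}
    (hT : shift k v '' prototile d ∈ 𝒯) :
    ∃ σ, shift (k + 1) (v - (2 : ℝ) ^ k • signVec σ) '' prototile d ∈ 𝒯 := by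
  obtain ⟨σ, hσ⟩ := (h.preimage (shiftIsom k v)).exists_parent hd hT
  refine ⟨σ, ?_⟩
  rw [Set.mem_ofPred_eq, shiftIsom_image, shift_image_shift, smul_neg, neg_add_eq_sub] at hσ
  exact hσ

theorem IsTil.child_grid (hd : 1 ≤ d) (h : IsTil 𝒯) {k : ℤ} {v : EuclideanSpace ℝ (Fin d)}
    (hT : shift k v '' prototile d ∈ 𝒯) (σ : Fin d → ℤˣ) :
    shift (k - 1) ((2 : ℝ) ^ k • (1 / 2 : ℝ) • signVec σ + v) '' prototile d ∈ 𝒯 := by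
  have hσ := (h.preimage (shiftIsom k v)).child_mem hd hT σ
  rw [Set.mem_ofPred_eq, shiftIsom_image, shift_image_shift] at hσ
  exact hσ

theorem IsTil.exists_layer (hd : 1 ≤ d) (h : IsTil 𝒯) (hB : prototile d ∈ 𝒯) (k : ℤ) :
    ∃ v, shift k v '' prototile d ∈ 𝒯 := by
  induction k using Int.induction_on with
  | zero => exact ⟨0, by rwa [shift_zero_image]⟩
  | succ n ih =>
    obtain ⟨v, hv⟩ := ih
    obtain ⟨σ, hσ⟩ := h.parent_grid hd hv
    exact ⟨_, hσ⟩
  | pred n ih =>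
    obtain ⟨v, hv⟩ := ih
    exact ⟨_, h.child_grid hd hv 1⟩

theorem IsTil.translate_grid (hd : 1 ≤ d) (h : IsTil 𝒯) {k : ℤ} {v : EuclideanSpace ℝ (Fin d)}
    (hT : shift k v '' prototile d ∈ 𝒯) (z : Fin d → ℤ) :
    shift k (v + (2 : ℝ) ^ (k + 1) • intVec z) '' prototile d ∈ 𝒯 := by
  -- The periods of layer `k`. The generators come with both signs, so a submonoid suffices.
  let M : AddSubmonoid (EuclideanSpace ℝ (Fin d)) :=
    { carrier := {w | ∀ v, shift k v '' prototile d ∈ 𝒯 → shift k (v + w) '' prototile d ∈ 𝒯}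
      zero_mem' := fun v hv => by rwa [add_zero]
      add_mem' := fun {a b} ha hb v hv => by
        rw [← add_assoc]; exact hb _ (ha _ hv) }
  have hgen : ∀ (i : Fin d) (ε : ℤˣ),
      (2 : ℝ) ^ k • EuclideanSpace.single i (2 * ((ε : ℤ) : ℝ)) ∈ M := by
    intro i ε v hv
    have := (h.preimage (shiftIsom k v)).sibling_mem hd hv i ε
    rw [Set.mem_ofPred_eq, shiftIsom_image, shift_image_shift, add_zero, add_comm] at this
    exact this
  have hsum : (2 : ℝ) ^ (k + 1) • intVec z = ∑ i, (z i).natAbs •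
      ((2 : ℝ) ^ k • EuclideanSpace.single i
        (2 * (((if 0 ≤ z i then 1 else -1 : ℤˣ) : ℤ) : ℝ))) := by
    ext j
    simp only [PiLp.smul_apply, intVec_apply, smul_eq_mul, WithLp.ofLp_sum, Finset.sum_apply,
      PiLp.single_apply, nsmul_eq_mul]
    rw [Finset.sum_eq_single j (fun i _ hi => by simp [hi.symm])
      (fun hj => absurd (Finset.mem_univ j) hj), two_zpow_succ]
    have : ((z j).natAbs : ℝ) = |((z j : ℤ) : ℝ)| := by
      rw [← Int.cast_abs, Int.abs_eq_natAbs]; simp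
    rw [this]
    by_cases hz : 0 ≤ z j
    · have : (0 : ℝ) ≤ z j := by exact_mod_cast hz
      simp [hz, abs_of_nonneg this]
      ring
    · have : ((z j : ℤ) : ℝ) < 0 := by exact_mod_cast not_le.1 hz
      simp [hz, abs_of_neg this]
      ring
  have : (2 : ℝ) ^ (k + 1) • intVec z ∈ M := by
    rw [hsum]
    exact M.sum_mem fun i _ => M.nsmul_mem (hgen i _) _
  exact this v hT

theorem exists_near_translate (k : ℤ) (v x : EuclideanSpace ℝ (Fin d)) :
    ∃ z : Fin d → ℤ, ∀ i, |x i - (v + (2 : ℝ) ^ (k + 1) • intVec z) i| ≤ 2 ^ k := by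
  have h2 : (0 : ℝ) < 2 ^ k := by positivity
  refine ⟨fun i => round ((x i - v i) / 2 ^ (k + 1)), fun i => ?_⟩
  have := abs_sub_round ((x i - v i) / 2 ^ (k + 1))
  simp only [PiLp.add_apply, PiLp.smul_apply, intVec_apply, smul_eq_mul]
  have e : x i - (v i + 2 ^ (k + 1) * ((round ((x i - v i) / 2 ^ (k + 1)) : ℤ) : ℝ)) =
      2 ^ (k + 1) * ((x i - v i) / 2 ^ (k + 1) -
        ((round ((x i - v i) / 2 ^ (k + 1)) : ℤ) : ℝ)) := by
    field_simp
    ring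
  have h3 : (0 : ℝ) < 2 ^ (k + 1) := by positivity
  rw [e, abs_mul, abs_of_pos h3]
  calc _ ≤ (2 : ℝ) ^ (k + 1) * (1 / 2) := by gcongr
    _ = 2 ^ k := by rw [two_zpow_succ]; ring

/-- The centre of `T` lies in some grid tile, and it is an interior point of `T`. -/
theorem IsTil.exists_eq_shift (hd : 1 ≤ d) (h : IsTil 𝒯) (hB : prototile d ∈ 𝒯)
    {T : Set (HSpace d)} (hT : T ∈ 𝒯) : ∃ k v, T = shift k v '' prototile d := by
  obtain ⟨g, rfl⟩ := h.copy T hT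
  let c₀ : HSpace d := ⟨0, 3 / 2, by norm_num⟩
  obtain ⟨k, hk1, hk2⟩ := exists_mem_Ico_zpow (g c₀).pos (one_lt_two (α := ℝ))
  obtain ⟨v, hv⟩ := h.exists_layer hd hB k
  obtain ⟨z, hz⟩ := exists_near_translate k v (g c₀).x
  refine ⟨k, _, h.eq_of_mem_open hd hT (h.translate_grid hd hv z) (q := c₀) ?_
    (mem_shift_prototile.2 ⟨hz, hk1, hk2.le⟩)⟩
  refine ⟨fun i => by simp [c₀], ?_, ?_⟩ <;> norm_num [c₀]

theorem IsTil.exists_intVec (hd : 1 ≤ d) (h : IsTil 𝒯) {k : ℤ}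
    {v w : EuclideanSpace ℝ (Fin d)} (hv : shift k v '' prototile d ∈ 𝒯)
    (hw : shift k w '' prototile d ∈ 𝒯) :
    ∃ z : Fin d → ℤ, w = v + (2 : ℝ) ^ (k + 1) • intVec z := by
  obtain ⟨z, hz⟩ := exists_near_translate k v w
  refine ⟨z, ?_⟩
  have hu := h.translate_grid hd hv z
  set u := v + (2 : ℝ) ^ (k + 1) • intVec z
  have h2 : (0 : ℝ) < 2 ^ k := by positivity
  -- Midway between `w` and its nearest grid position `u`: as `|w i - u i| ≤ 2^k`, this is an
  -- interior point of the tile at `u` that also lies in the tile at `w`.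
  let q : HSpace d := ⟨(1 / 2 : ℝ) • (w + u), 2 ^ k * (3 / 2), by positivity⟩
  have hq : (shiftIsom k u).symm q ∈ openPrototile d := by
    refine ⟨fun i => ?_, ?_, ?_⟩
    · rw [shiftIsom_symm_x, abs_div, abs_of_pos h2, div_lt_one h2]
      have := hz i
      have e : q.x i - u i = (1 / 2) * (w i - u i) := by simp [q]; ring
      rw [e, abs_mul, abs_of_pos one_half_pos]
      linarith
    · rw [shiftIsom_symm_t, lt_div_iff₀ h2]
      simp only [q]
      linarith
    · rw [shiftIsom_symm_t, div_lt_iff₀ h2]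
      simp only [q]
      linarith
  have := h.eq_of_mem_open hd (g := shiftIsom k u) hu hw hq (by
    rw [HIsom.apply_symm, mem_shift_prototile, two_zpow_succ]
    refine ⟨fun i => ?_, ?_, ?_⟩
    · have := hz i
      have e : q.x i - w i = -((1 / 2) * (w i - u i)) := by simp [q]; ring
      rw [e, abs_neg, abs_mul, abs_of_pos one_half_pos]
      linarith
    · simp only [q]
      linarith
    · simp only [q]
      linarith)
  exact (shift_prototile_injective this).2.symm

end Grid

/-! ### Tails -/

theorem isAFacet_iff (hd : 1 ≤ d) {g : HIsom d} {F : Set (HSpace d)} :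
    IsAFacet (g '' prototile d) F ↔ F = g '' facet .a := by
  constructor
  · rintro ⟨g', h1, rfl⟩
    have hk : g.symm.comp g' '' prototile d = prototile d := by
      rw [HIsom.comp_image, ← h1, g.symm_image_image]
    have := image_facet_a_of_symmetry hd _ hk
    rw [HIsom.comp_image] at this
    rw [← this, g.image_symm_image, this]
  · rintro rfl
    exact ⟨g, rfl, rfl⟩

/-- One step of a tail in terms of the coordinates of the tiles. -/
theorem down_iff (hd : 1 ≤ d) {g : HIsom d} {k : ℤ} {v : EuclideanSpace ℝ (Fin d)}
    {T' : Set (HSpace d)} {σ : Fin d → ℤˣ} :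
    (∃ F, IsAFacet (g '' (shift k v '' prototile d)) F ∧ IsBFacetLabelled g T' F σ) ↔
      T' = g '' (shift (k + 1) (v - (2 : ℝ) ^ k • signVec σ) '' prototile d) := by
  have hA : ∀ F, IsAFacet (g '' (shift k v '' prototile d)) F ↔
      F = g '' (shift k v '' facet .a) := by
    intro F
    rw [← shiftIsom_image, ← HIsom.comp_image, isAFacet_iff hd, HIsom.comp_image, shiftIsom_image]
  constructor
  · rintro ⟨F, hF, l, w, rfl, hF'⟩
    rw [hA] at hF
    rw [hF] at hF'
    have := g.image_injective hF'
    rw [shift_facet_b] at this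
    obtain ⟨rfl, rfl⟩ := shift_facet_a_injective this
    simp
  · rintro rfl
    refine ⟨_, (hA _).2 rfl, _, _, rfl, ?_⟩
    rw [shift_facet_b]
    simp

theorem signVec_injective : Function.Injective (signVec (d := d)) := by
  intro σ τ h
  funext i
  have := congrArg (fun x : EuclideanSpace ℝ (Fin d) => x i) h
  exact Units.ext (Int.cast_injective (α := ℝ) this)

section Tail

variable {𝒯 : Set (Set (HSpace d))} {g : HIsom d}

theorem IsTail.exists_coords (hd : 1 ≤ d) {k : ℤ} {v : EuclideanSpace ℝ (Fin d)}
    {t : ℕ → Set (HSpace d)} {s : ℕ → Fin d → ℤˣ}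
    (ht : IsTail 𝒯 g (g '' (shift k v '' prototile d)) t s) :
    ∃ w : ℕ → EuclideanSpace ℝ (Fin d), w 0 = v ∧
      (∀ j, w (j + 1) = w j - (2 : ℝ) ^ (k + j) • signVec (s j)) ∧
      ∀ j : ℕ, g '' (shift (k + j) (w j) '' prototile d) ∈ 𝒯 := by
  let w : ℕ → EuclideanSpace ℝ (Fin d) := fun j =>
    Nat.rec v (fun j x => x - (2 : ℝ) ^ (k + j) • signVec (s j)) j
  have hw : ∀ j : ℕ, t j = g '' (shift (k + j) (w j) '' prototile d) := by
    intro j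
    induction j with
    | zero => simpa [w] using ht.start
    | succ j ih =>
      have := ht.down j
      rw [ih, down_iff hd] at this
      rw [this]
      push_cast
      rw [add_assoc]
  exact ⟨w, rfl, fun j => rfl, fun j => hw j ▸ ht.mem j⟩

theorem exists_int_sub (hd : 1 ≤ d) (h : IsTil {T | g '' T ∈ 𝒯}) {k : ℤ}
    {v w : EuclideanSpace ℝ (Fin d)}
    (hv : g '' (shift k v '' prototile d) ∈ 𝒯) (hw : g '' (shift k w '' prototile d) ∈ 𝒯) :
    ∃ z : Fin d → ℤ, ∀ i, w i - v i = 2 ^ k * 2 * z i := by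
  obtain ⟨z, rfl⟩ := h.exists_intVec hd hv hw
  refine ⟨z, fun i => ?_⟩
  rw [← two_zpow_succ]
  simp

/-- The candidates differ by `2^k (σ - τ)`, a multiple of `4 · 2^k` in every coordinate, while the
entries of `σ - τ` are 0 or `±2`. -/
theorem parent_unique (hd : 1 ≤ d) (h : IsTil {T | g '' T ∈ 𝒯}) {k : ℤ}
    {v : EuclideanSpace ℝ (Fin d)} {σ τ : Fin d → ℤˣ}
    (hσ : g '' (shift (k + 1) (v - (2 : ℝ) ^ k • signVec σ) '' prototile d) ∈ 𝒯)
    (hτ : g '' (shift (k + 1) (v - (2 : ℝ) ^ k • signVec τ) '' prototile d) ∈ 𝒯) : σ = τ := by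
  obtain ⟨z, hz⟩ := exists_int_sub hd h hσ hτ
  funext i
  have h1 := hz i
  have h2 : (0 : ℝ) < 2 ^ k := by positivity
  rw [two_zpow_succ] at h1
  simp only [PiLp.sub_apply, PiLp.smul_apply, signVec_apply, smul_eq_mul] at h1
  have h3 : (2 : ℝ) ^ k * (((σ i : ℤ) : ℝ) - ((τ i : ℤ) : ℝ) - 4 * z i) = 0 := by linarith
  have h4 := (mul_eq_zero.1 h3).resolve_left h2.ne'
  have h5 : (σ i : ℤ) - (τ i : ℤ) - 4 * z i = 0 := by exact_mod_cast h4
  rcases Int.units_eq_one_or (σ i) with e | e <;> rcases Int.units_eq_one_or (τ i) with e' | e' <;>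
    rw [e, e'] at h5 ⊢ <;> simp at h5 <;> omega

theorem existsUnique_tailSequence (hd : 1 ≤ d) (h : IsTil {T | g '' T ∈ 𝒯}) {k : ℤ}
    {v : EuclideanSpace ℝ (Fin d)} (hT : g '' (shift k v '' prototile d) ∈ 𝒯) :
    ∃! s, IsTailSequence 𝒯 g (g '' (shift k v '' prototile d)) s := by
  have hex : ∀ (k : ℤ) (v : EuclideanSpace ℝ (Fin d)), ∃ σ,
      g '' (shift k v '' prototile d) ∈ 𝒯 →
        g '' (shift (k + 1) (v - (2 : ℝ) ^ k • signVec σ) '' prototile d) ∈ 𝒯 := by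
    intro k v
    by_cases hm : g '' (shift k v '' prototile d) ∈ 𝒯
    · obtain ⟨σ, hσ⟩ := h.parent_grid hd hm
      exact ⟨σ, fun _ => hσ⟩
    -- An arbitrary label off the tiling, so that the parent choice is total and can be iterated.
    · exact ⟨1, fun h => absurd h hm⟩
  choose σ hσ using hex
  let w : ℕ → EuclideanSpace ℝ (Fin d) := fun j =>
    Nat.rec v (fun j x => x - (2 : ℝ) ^ (k + j) • signVec (σ (k + j) x)) j
  have hw : ∀ j, w (j + 1) = w j - (2 : ℝ) ^ (k + j) • signVec (σ (k + j) (w j)) := fun _ => rfl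
  have hcast : ∀ j : ℕ, k + ((j + 1 : ℕ) : ℤ) = k + j + 1 := fun j => by push_cast; ring
  have hmem : ∀ j : ℕ, g '' (shift (k + j) (w j) '' prototile d) ∈ 𝒯 := by
    intro j
    induction j with
    | zero => simpa [w] using hT
    | succ j ih =>
      rw [hw, hcast]
      exact hσ _ _ ih
  refine ⟨fun j => σ (k + j) (w j),
    ⟨fun j => g '' (shift (k + j) (w j) '' prototile d), ?_, hmem, ?_, ?_⟩, ?_⟩
  · simp [w]
  · intro i j hij
    have := (shift_prototile_injective (g.image_injective hij)).1
    omega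
  · intro j
    rw [down_iff hd, hw, hcast]
  · rintro s ⟨t, ht⟩
    obtain ⟨w', h0, h1, h2⟩ := ht.exists_coords hd
    have hww : ∀ j, w' j = w j := by
      intro j
      induction j with
      | zero => exact h0
      | succ j ih =>
        have a1 := h2 (j + 1)
        have a2 := hmem (j + 1)
        rw [h1, ih, hcast] at a1
        rw [hw, hcast] at a2
        rw [h1, hw, ih, parent_unique hd h a1 a2]
    funext j
    apply signVec_injective
    have e1 := h1 j
    rw [hww, hww, hw] at e1
    have h2 : (2 : ℝ) ^ (k + j) ≠ 0 := by positivity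
    exact smul_right_injective _ h2 (sub_right_injective e1).symm

end Tail

/-- The coordinate of the difference of two tails is eventually constant. -/
theorem eventually_eq_or_neg {z : ℕ → ℤ} {σ τ : ℕ → ℤˣ}
    (h : ∀ j, 2 * z j = 4 * z (j + 1) + ((σ j : ℤ) - (τ j : ℤ))) :
    ∃ m, (∀ j ≥ m, σ j = τ j) ∨ ∀ j ≥ m, σ j = - τ j := by
  by_cases hz : ∃ m, z m = 0
  · obtain ⟨m, hm⟩ := hz
    -- From `z j = 0` the equation needs `4 ∣ σ j - τ j`, so the signs agree and `z` stays 0.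
    have hz : ∀ j ≥ m, z j = 0 ∧ σ j = τ j := by
      have step : ∀ j, z j = 0 → σ j = τ j ∧ z (j + 1) = 0 := by
        intro j hj
        have := h j
        rcases Int.units_eq_one_or (σ j) with e | e <;>
          rcases Int.units_eq_one_or (τ j) with e' | e' <;>
          rw [e, e', hj] at this <;> rw [e, e'] <;> simp at this ⊢ <;> omega
      intro j hj
      induction j, hj using Nat.le_induction with
      | base => exact ⟨hm, (step m hm).1⟩
      | succ j _ ih =>
        have := (step j ih.1).2
        exact ⟨this, (step _ this).1⟩
    exact ⟨m, Or.inl fun j hj => (hz j hj).2⟩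
  · push Not at hz
    have hσ : ∀ j, -2 ≤ (τ j : ℤ) - (σ j : ℤ) ∧ (τ j : ℤ) - (σ j : ℤ) ≤ 2 := by
      intro j
      rcases Int.units_eq_one_or (σ j) with e | e <;>
        rcases Int.units_eq_one_or (τ j) with e' | e' <;> simp [e, e']
    -- The equation gives `|z (j+1)| ≤ (|z j| + 1) / 2`, so a nonzero `z` drops by at least 1 until
    -- it reaches absolute value 1.
    have hdec : ∀ j, (z (j + 1)).natAbs ≤ max 1 ((z j).natAbs - 1) := by
      intro j
      have h1 := h j
      have h2 := hσ j
      have h3 := hz j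
      omega
    have hone : ∀ j, (z j).natAbs ≤ max 1 ((z 0).natAbs - j) := by
      intro j
      induction j with
      | zero => simp
      | succ j ih =>
        have := hdec j
        omega
    -- From here on `|z j| = 1`, and `2 z j - 4 z (j+1)` cannot vanish, so the signs differ.
    refine ⟨(z 0).natAbs, Or.inr fun j hj => ?_⟩
    have h1 := h j
    have h2 := hone j
    have h3 := hz j
    rcases Int.units_eq_one_or (σ j) with e | e <;>
      rcases Int.units_eq_one_or (τ j) with e' | e' <;> rw [e, e'] at h1 ⊢ <;> simp at h1 ⊢ <;>
      omega

theorem eventually_eq_or_neg_of_coords {k : ℤ} {w w' : ℕ → EuclideanSpace ℝ (Fin d)}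
    {s s' : ℕ → Fin d → ℤˣ}
    (h : ∀ j, w (j + 1) = w j - (2 : ℝ) ^ (k + j) • signVec (s j))
    (h' : ∀ j, w' (j + 1) = w' j - (2 : ℝ) ^ (k + j) • signVec (s' j))
    (hz : ∀ j, ∃ z : Fin d → ℤ, ∀ i, w j i - w' j i = 2 ^ (k + j) * 2 * z i) :
    ∃ m, ∀ i, (∀ j ≥ m, s j i = s' j i) ∨ ∀ j ≥ m, s j i = - s' j i := by
  choose z hz using hz
  have key : ∀ i, ∃ m, (∀ j ≥ m, s j i = s' j i) ∨ ∀ j ≥ m, s j i = - s' j i := by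
    intro i
    refine eventually_eq_or_neg (z := fun j => z j i) fun j => ?_
    have e := hz j i
    have e' := hz (j + 1) i
    have h2 : (0 : ℝ) < 2 ^ (k + j) := by positivity
    rw [h, h', show k + ((j + 1 : ℕ) : ℤ) = k + j + 1 by push_cast; ring, two_zpow_succ] at e'
    simp only [PiLp.sub_apply, PiLp.smul_apply, signVec_apply, smul_eq_mul] at e'
    have e3 : (2 : ℝ) ^ (k + j) * (2 * (z j i : ℝ) -
        (4 * (z (j + 1) i : ℝ) + (((s j i : ℤ) : ℝ) - ((s' j i : ℤ) : ℝ)))) = 0 := by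
      linarith
    have e4 := sub_eq_zero.1 ((mul_eq_zero.1 e3).resolve_left h2.ne')
    exact_mod_cast e4
  choose m hm using key
  refine ⟨Finset.univ.sup m, fun i => ?_⟩
  have hle : m i ≤ Finset.univ.sup m := Finset.le_sup (Finset.mem_univ i)
  exact (hm i).imp (fun H j hj => H j (hle.trans hj)) fun H j hj => H j (hle.trans hj)

/-! ### Aligning the tails of two tiles -/

theorem level_eq_of_subset {g : HIsom d} {k l : ℤ} {v : EuclideanSpace ℝ (Fin d)}
    (h : g '' (shift k v '' prototile d) ⊆
      g '' {p | (2 : ℝ) ^ l ≤ p.t ∧ p.t ≤ (2 : ℝ) ^ (l + 1)}) : k = l := by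
  rw [Set.image_subset_image_iff g.injective] at h
  have h1 := h ((mem_shift_prototile (k := k) (v := v) (p := ⟨v, 2 ^ k, by positivity⟩)).2
    ⟨fun i => by simp; positivity, le_rfl, zpow_le_zpow_right₀ one_le_two (by omega)⟩)
  have h2 := h ((mem_shift_prototile (k := k) (v := v) (p := ⟨v, 2 ^ (k + 1), by positivity⟩)).2
    ⟨fun i => by simp; positivity, zpow_le_zpow_right₀ one_le_two (by omega), le_rfl⟩)
  have h3 := (zpow_le_zpow_iff_right₀ (one_lt_two (α := ℝ))).1 h1.1
  have h4 := (zpow_le_zpow_iff_right₀ (one_lt_two (α := ℝ))).1 h2.2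
  omega

theorem exists_coords_of_mem {𝒯 : Set (Set (HSpace d))} {g : HIsom d} (hd : 1 ≤ d)
    (h : IsTil {T | g '' T ∈ 𝒯}) (hg : g '' prototile d ∈ 𝒯) {T : Set (HSpace d)} (hT : T ∈ 𝒯) :
    ∃ k v, T = g '' (shift k v '' prototile d) := by
  obtain ⟨k, v, e⟩ := h.exists_eq_shift hd hg (T := g.symm '' T) (by simpa using hT)
  exact ⟨k, v, by rw [← e, g.image_symm_image]⟩

/-- Dropping `a` and `b` terms brings both tails to a common layer, where positions differ by a
multiple of the period. The first claim of the theorem uses the gap between the layers, the second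
`a = b = 0`. -/
theorem tails_eventually_eq_or_neg {𝒯 : Set (Set (HSpace d))} {g : HIsom d} (hd : 1 ≤ d)
    (h : IsTil {T | g '' T ∈ 𝒯}) {k l : ℤ} {v w : EuclideanSpace ℝ (Fin d)}
    {s s' : ℕ → Fin d → ℤˣ}
    (hs : IsTailSequence 𝒯 g (g '' (shift k v '' prototile d)) s)
    (hs' : IsTailSequence 𝒯 g (g '' (shift l w '' prototile d)) s') {a b : ℕ}
    (hab : k + a = l + b) :
    ∃ m, ∀ i, (∀ j ≥ m, s (j + a) i = s' (j + b) i) ∨ ∀ j ≥ m, s (j + a) i = -s' (j + b) i := by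
  obtain ⟨t, ht⟩ := hs
  obtain ⟨t', ht'⟩ := hs'
  obtain ⟨x, -, hx, hx'⟩ := ht.exists_coords hd
  obtain ⟨y, -, hy, hy'⟩ := ht'.exists_coords hd
  have ea : ∀ j : ℕ, k + ((j + a : ℕ) : ℤ) = k + a + j := fun j => by push_cast; ring
  have eb : ∀ j : ℕ, l + ((j + b : ℕ) : ℤ) = k + a + j := fun j => by rw [hab]; push_cast; ring
  refine eventually_eq_or_neg_of_coords (k := k + a) (w := fun j => x (j + a))
    (w' := fun j => y (j + b)) (s := fun j => s (j + a)) (s' := fun j => s' (j + b))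
    (fun j => ?_) (fun j => ?_) (fun j => ?_)
  · rw [← ea, ← hx, add_right_comm]
  · rw [← eb, ← hy, add_right_comm]
  · have h1 := hx' (j + a)
    have h2 := hy' (j + b)
    rw [ea] at h1
    rw [eb] at h2
    exact exists_int_sub hd h h2 h1

end Boroczky

theorem mainTheorem6 (d : ℕ) (hd : 1 ≤ d) (𝒯 : Set (Set (Boroczky.HSpace d)))
    (h𝒯 : Boroczky.IsBTiling 𝒯) (g : Boroczky.HIsom d) (hg : g '' Boroczky.prototile d ∈ 𝒯) :
    (∀ T ∈ 𝒯, ∃! s : ℕ → Fin d → ℤˣ, Boroczky.IsTailSequence 𝒯 g T s) ∧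
    ∀ T ∈ 𝒯, ∀ T' ∈ 𝒯, ∀ s s' : ℕ → Fin d → ℤˣ,
      Boroczky.IsTailSequence 𝒯 g T s → Boroczky.IsTailSequence 𝒯 g T' s' →
      (∃ m n : ℕ, ∀ i : Fin d,
        (∀ j : ℕ, s (j + m) i = s' (j + n) i) ∨ (∀ j : ℕ, s (j + m) i = -s' (j + n) i)) ∧
      (Boroczky.SameLayer g T T' → ∃ m : ℕ, ∀ i : Fin d,
        (∀ j ≥ m, s j i = s' j i) ∨ (∀ j ≥ m, s j i = -s' j i)) := by
  have h := h𝒯.isTil.preimage g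
  refine ⟨fun T hT => ?_, fun T hT T' hT' s s' hs hs' => ?_⟩
  · obtain ⟨k, v, rfl⟩ := Boroczky.exists_coords_of_mem hd h hg hT
    exact Boroczky.existsUnique_tailSequence hd h hT
  obtain ⟨k, v, rfl⟩ := Boroczky.exists_coords_of_mem hd h hg hT
  obtain ⟨l, w, rfl⟩ := Boroczky.exists_coords_of_mem hd h hg hT'
  refine ⟨?_, ?_⟩
  -- Truncated differences: only the tail starting in the lower-numbered layer is advanced.
  · obtain ⟨m, hm⟩ := Boroczky.tails_eventually_eq_or_neg hd h hs hs'
      (a := (l - k).toNat) (b := (k - l).toNat) (by omega)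
    refine ⟨m + (l - k).toNat, m + (k - l).toNat, fun i => ?_⟩
    refine (hm i).imp (fun H j => ?_) fun H j => ?_ <;>
    · rw [← add_assoc, ← add_assoc]
      exact H (j + m) (Nat.le_add_left m j)
  · rintro ⟨n, h1, h2⟩
    obtain rfl := Boroczky.level_eq_of_subset h1
    obtain rfl := Boroczky.level_eq_of_subset h2
    exact Boroczky.tails_eventually_eq_or_neg hd h hs hs' (a := 0) (b := 0) rfl
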